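/- **Setting.** Fix a probability space $(\Omega,\mathcal F,P)$, $\Sigma=\{1,\dots,d\}$, and let $\Sigma^+$ (resp. $\Sigma^*$) be the set of nonempty (resp. all) finite words over $\Sigma$. All processes have time axis $\mathbb Z$, and equalities of random variables hold almost surely. For an $\mathbb R^d$-valued process $\mu$ and $w=\sigma_1\cdots\sigma_k$ put $\mu_w(t)=\mu_{\sigma_1}(t-k+1)\cdots\mu_{\sigma_k}(t)$, $\mu_\epsilon=1$; for matrices put $A_w=A_{\sigma_k}\cdots A_{\sigma_1}$, $A_\epsilon=I$. The process $\mu$ is *admissible* with $\mathcal E\subseteq\Sigma\times\Sigma$ and positive numbers $(p_\sigma)_{\sigma\in\Sigma}$ if the following holds, where $L$ is the set of words $\sigma_1\cdots\sigma_k\in\Sigma^+$ with all $(\sigma_i,\sigma_{i+1})\in\mathcal E$ and $\mathcal F^{\mu,-}_t$, $\mathcal F^{\mu,+}_t$ are the $\sigma$-algebras generated by $\{\mu(k)\}_{k<t}$ and $\{\mu(k)\}_{k\ge t}$: (1) for each $\sigma$ there is $\sigma'$ with $(\sigma,\sigma')\in\mathcal E$, and $\mu_w=0$ for $w\in\Sigma^+\setminus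 L$; (2) for $w,v\in\Sigma^+$, $\sigma,\sigma'\in\Sigma$, $t\in\mathbb Z$: $E[\mu_{w\sigma}(t)\mu_{v\sigma'}(t)\mid\mathcal F^{\mu,-}_t]$ equals $p_\sigma\mu_w(t-1)\mu_v(t-1)$ if $\sigma=\sigma'$ and $w\sigma,v\sigma\in L$, and $0$ otherwise; $E[\mu_{w\sigma}(t)\mu_{\sigma'}(t)\mid\mathcal F^{\mu,-}_t]$ equals $p_\sigma\mu_w(t-1)$ if $\sigma=\sigma'$ and $w\sigma\in L$, and $0$ otherwise; and $E[\mu_\sigma(t)\mu_{\sigma'}(t)\mid\mathcal F^{\mu,-}_t]=0$ if $\sigma\ne\sigma'$; (3) there are reals $\alpha_\sigma$ with $\sum_\sigma\alpha_\sigma\mu_\sigma(t)=1$ for all $t$; (4) for all $w,v\in\Sigma^+$ the process $[\mu_w,\mu_v]^T$ is wide-sense stationary. Put $p_w=p_{\sigma_1}\cdots p_{\sigma_k}$ and, for a process $r$, $z^r_w(t)=r(t-|w|)\,\mu_w(t-1)/\sqrt{p_w}$. The process $r$ is *ZMWSSI* if, for all $t$, the $\sigma$-algebra generated by $\{r(k)\}_{k\le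 t}$ and $\mathcal F^{\mu,+}_t$ are conditionally independent given $\mathcal F^{\mu,-}_t$, and $r$, $\{z^r_w\}_{w\in\Sigma^+}$ are zero mean, square integrable and jointly wide-sense stationary. A ZMWSSI process $r$ is a *white noise w.r.t. $\mu$* if $E[z^r_w(t)z^r_v(t)^T]=0$ for $w\ne v$ in $\Sigma^+$, $E[z^r_{\sigma v}(t)z^r_{\sigma v}(t)^T]=E[z^r_\sigma(t)z^r_\sigma(t)^T]$ whenever $\sigma v\in L$, and $E[z^r_\sigma(t)z^r_\sigma(t)^T]$ is nonsingular for all $\sigma\in\Sigma$. A *stationary generalized linear switched system* (sGLSS) of $(y,u,\mu)$ of dimension $n_x$ is a system $$x(t+1)=\sum_{i=1}^{d}\bigl(A_ix(t)+B_iu(t)+K_iv(t)\bigr)\mu_i(t),\qquad y(t)=Cx(t)+Du(t)+Fv(t),\qquad t\in\mathbb Z,$$ with real matrices, an $\mathbb R^{n_x}$-valued state process $x$ and a noise process $v$ of any finite dimension, such that, with $\mathbf w=[v^T,u^T]^T$: (i) $\mathbf w$ is a white noise w.r.t. $\mu$ and $E[z^v_\sigma(t)z^u_\sigma(t)^T]=0$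 for all $\sigma$; (ii) $[x^T,\mathbf w^T]^T$ is ZMWSSI, $E[z^x_\sigma(t)z^{\mathbf w}_\sigma(t)^T]=0$ for all $\sigma\in\Sigma$ and $E[\mathbf w(t)z^x_w(t)^T]=0$ for all $w\in\Sigma^+$; (iii) all eigenvalues of $\sum_\sigma p_\sigma A_\sigma\otimes A_\sigma$ lie in the open unit disc; (iv) if $(\sigma_1,\sigma_2)\notin\mathcal E$, then $A_{\sigma_2}A_{\sigma_1}=0$ and $A_{\sigma_2}[K_{\sigma_1}\ B_{\sigma_1}]\,E[z^{\mathbf w}_{\sigma_1}(t)z^{\mathbf w}_{\sigma_1}(t)^T]=0$. The *stochastic part* $S_s$ of an sGLSS $S$ is the system $(\{A_\sigma,K_\sigma\}_{\sigma\in\Sigma},C,F,v)$, with state $x^s(t)=x(t)-x^d(t)$, where $x^d(t)$ is the (componentwise) orthogonal projection in $L^2$ of $x(t)$ onto the closed subspace generated by the components of $u(t)$ and $z^u_w(t)$, $w\in\Sigma^+$. With $$G_\sigma=\sqrt{p_\sigma}\,\bigl(A_\sigma P_\sigma C^T+K_\sigma Q_\sigma F^T\bigr),\quad P_\sigma=E[z^{x^s}_\sigma(t)z^{x^s}_\sigma(t)^T],\quad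 Q_\sigma=E[z^v_\sigma(t)z^v_\sigma(t)^T]$$ (which do not depend on $t$), $S_s$ is *reachable* (as a stationary generalized bilinear system) if the columns of the matrices $A_wG_\sigma$, $w\in\Sigma^*$, $\sigma\in\Sigma$, span $\mathbb R^{n_x}$, and *observable* if $\bigcap_{w\in\Sigma^*}\ker CA_w=\{0\}$. **Corollary 2 (Minimality).** Let $\mu$ be admissible with $\mathcal E$ and $(p_\sigma)$, and let $S$ be an sGLSS of $(y,u,\mu)$ whose stochastic part $S_s$ is observable and reachable. Then $S$ has minimal dimension among all sGLSSs of $(y,u,\mu)$ (with the same $\mathcal E$ and $(p_\sigma)$): every sGLSS $\hat S$ of $(y,u,\mu)$, with noise $\hat v$ of any dimension, has state dimension at least that of $S$. -/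

import Mathlib

open MeasureTheory
open scoped Kronecker Matrix

noncomputable section

namespace SwitchedStoch

/-- A discrete-time process on the time axis `ℤ` with values in `ℝ^ι`. -/
abbrev Proc (Ω : Type*) (ι : Type*) := ℤ → Ω → ι → ℝ

/-- `E[a bᵀ]`. -/
def crossCov {Ω ι κ : Type*} [MeasurableSpace Ω] (P : Measure Ω)
    (a : Ω → ι → ℝ) (b : Ω → κ → ℝ) : Matrix ι κ ℝ :=
  Matrix.of fun i j => ∫ ω, a ω i * b ω j ∂P

/-- The stacked process `[aᵀ, bᵀ]ᵀ`. -/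
def stack {Ω ι κ : Type*} (a : Proc Ω ι) (b : Proc Ω κ) : Proc Ω (ι ⊕ κ) :=
  fun t ω => Sum.elim (a t ω) (b t ω)

/-- A family of real processes is jointly wide-sense stationary: all are square integrable, with
constant mean and shift-invariant second moments. -/
structure JointlyWSS {Ω J : Type*} [MeasurableSpace Ω] (P : Measure Ω)
    (h : J → ℤ → Ω → ℝ) : Prop where
  memLp : ∀ j t, MemLp (h j t) 2 P
  mean : ∀ j t s, ∫ ω, h j t ω ∂P = ∫ ω, h j s ω ∂P
  moment : ∀ i j t s k,
    ∫ ω, h i (t + k) ω * h j (s + k) ω ∂P = ∫ ω, h i t ω * h j s ω ∂P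

/-- Conditional independence of the sigma-algebras `m₁`, `m₂` given `m`, on an arbitrary
probability space. -/
def CondIndepGiven {Ω : Type*} [MeasurableSpace Ω] (P : Measure Ω)
    (m m₁ m₂ : MeasurableSpace Ω) : Prop :=
  ∀ s₁ s₂ : Set Ω, MeasurableSet[m₁] s₁ → MeasurableSet[m₂] s₂ →
    P[(s₁ ∩ s₂).indicator (fun _ => (1 : ℝ)) | m] =ᵐ[P]
      P[s₁.indicator (fun _ => (1 : ℝ)) | m] * P[s₂.indicator (fun _ => (1 : ℝ)) | m]

/-- The sigma-algebra generated by `r k` for all times `k` in `T`. -/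
abbrev sigmaGen {Ω ι : Type*} (r : Proc Ω ι) (T : Set ℤ) : MeasurableSpace Ω :=
  ⨆ k ∈ T, MeasurableSpace.comap (r k) inferInstance

/-! ### Words over `Fin d` -/

/-- `w = σ₁⋯σₖ` is nonempty and all its transitions `(σᵢ, σᵢ₊₁)` are in `𝓔`. -/
def AdmWord {d : ℕ} (𝓔 : Set (Fin d × Fin d)) (w : List (Fin d)) : Prop :=
  w ≠ [] ∧ w.IsChain fun a b => (a, b) ∈ 𝓔

/-- `μ_w(t) = μ_{σ₁}(t-k+1) ⋯ μ_{σₖ}(t)` for `w = σ₁⋯σₖ`; it is `1` for the empty word. -/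
def switchWord {Ω : Type*} {d : ℕ} (μ : Proc Ω (Fin d)) : List (Fin d) → ℤ → Ω → ℝ
  | [], _, _ => 1
  | σ :: w, t, ω => μ (t - w.length) ω σ * switchWord μ w t ω

/-- `A_w = A_{σₖ} ⋯ A_{σ₁}` for `w = σ₁⋯σₖ`; it is the identity for the empty word. -/
def matWord {d n : ℕ} (A : Fin d → Matrix (Fin n) (Fin n) ℝ) :
    List (Fin d) → Matrix (Fin n) (Fin n) ℝ
  | [] => 1
  | σ :: w => matWord A w * A σ

/-- `z^r_w(t) = r(t-|w|) μ_w(t-1) / √p_w`, with `p_w` the product of the `p_σ` over the letters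
of `w`. For the empty word this is `r(t)`. -/
def zProc {Ω ι : Type*} {d : ℕ} (μ : Proc Ω (Fin d)) (p : Fin d → ℝ) (r : Proc Ω ι)
    (w : List (Fin d)) : Proc Ω ι :=
  fun t ω i => r (t - w.length) ω i * switchWord μ w (t - 1) ω * (1 / √((w.map p).prod))

/-! ### Admissible switching, ZMWSSI processes, white noise -/

/-- The switching process `μ` is admissible, with set of transitions `𝓔` and constants `p`. -/
structure IsAdmissible {Ω : Type*} [MeasurableSpace Ω] (P : Measure Ω) {d : ℕ}
    (μ : Proc Ω (Fin d)) (𝓔 : Set (Fin d × Fin d)) (p : Fin d → ℝ) : Prop where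
  measurable : ∀ t, Measurable (μ t)
  exists_succ : ∀ σ, ∃ σ', (σ, σ') ∈ 𝓔
  eq_zero : ∀ w : List (Fin d), w ≠ [] → ¬ AdmWord 𝓔 w → ∀ t, switchWord μ w t =ᵐ[P] 0
  p_pos : ∀ σ, 0 < p σ
  cond_same : ∀ (w v : List (Fin d)) (σ : Fin d) (t : ℤ), w ≠ [] → v ≠ [] →
    AdmWord 𝓔 (w ++ [σ]) → AdmWord 𝓔 (v ++ [σ]) →
    P[fun ω => switchWord μ (w ++ [σ]) t ω * switchWord μ (v ++ [σ]) t ω |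
        sigmaGen μ (Set.Iio t)] =ᵐ[P]
      fun ω => p σ * (switchWord μ w (t - 1) ω * switchWord μ v (t - 1) ω)
  cond_diff : ∀ (w v : List (Fin d)) (σ σ' : Fin d) (t : ℤ), w ≠ [] → v ≠ [] →
    ¬ (σ = σ' ∧ AdmWord 𝓔 (w ++ [σ]) ∧ AdmWord 𝓔 (v ++ [σ])) →
    P[fun ω => switchWord μ (w ++ [σ]) t ω * switchWord μ (v ++ [σ']) t ω |
        sigmaGen μ (Set.Iio t)] =ᵐ[P] 0
  cond_letter_same : ∀ (w : List (Fin d)) (σ : Fin d) (t : ℤ), w ≠ [] →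
    AdmWord 𝓔 (w ++ [σ]) →
    P[fun ω => switchWord μ (w ++ [σ]) t ω * μ t ω σ | sigmaGen μ (Set.Iio t)] =ᵐ[P]
      fun ω => p σ * switchWord μ w (t - 1) ω
  cond_letter_diff : ∀ (w : List (Fin d)) (σ σ' : Fin d) (t : ℤ), w ≠ [] →
    ¬ (σ = σ' ∧ AdmWord 𝓔 (w ++ [σ])) →
    P[fun ω => switchWord μ (w ++ [σ]) t ω * μ t ω σ' | sigmaGen μ (Set.Iio t)] =ᵐ[P] 0
  cond_letters : ∀ (σ σ' : Fin d) (t : ℤ), σ ≠ σ' →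
    P[fun ω => μ t ω σ * μ t ω σ' | sigmaGen μ (Set.Iio t)] =ᵐ[P] 0
  exists_alpha : ∃ α : Fin d → ℝ, ∀ t, ∀ᵐ ω ∂P, ∑ σ, α σ * μ t ω σ = 1
  stationary : ∀ w v : List (Fin d), w ≠ [] → v ≠ [] →
    JointlyWSS P ![switchWord μ w, switchWord μ v]

/-- `r` is zero mean wide sense stationary with respect to `μ`. The empty word contributes the
process `r` itself to the family `z^r_w`. -/
structure IsZMWSSI {Ω ι : Type*} [MeasurableSpace Ω] (P : Measure Ω) {d : ℕ}
    (μ : Proc Ω (Fin d)) (p : Fin d → ℝ) (r : Proc Ω ι) : Prop where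
  measurable : ∀ t, Measurable (r t)
  condIndep : ∀ t, CondIndepGiven P (sigmaGen μ (Set.Iio t))
    (sigmaGen r (Set.Iic t)) (sigmaGen μ (Set.Ici t))
  zero_mean : ∀ w t i, ∫ ω, zProc μ p r w t ω i ∂P = 0
  stationary : JointlyWSS P fun (j : List (Fin d) × ι) t ω => zProc μ p r j.1 t ω j.2

/-- `r` is a white noise with respect to `μ`. -/
structure IsWhiteNoise {Ω ι : Type*} [Fintype ι] [DecidableEq ι] [MeasurableSpace Ω]
    (P : Measure Ω) {d : ℕ} (μ : Proc Ω (Fin d)) (𝓔 : Set (Fin d × Fin d)) (p : Fin d → ℝ)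
    (r : Proc Ω ι) : Prop where
  zmwssi : IsZMWSSI P μ p r
  uncorrelated : ∀ (w v : List (Fin d)) (σ : Fin d) (t : ℤ), w ≠ [] → w ≠ σ :: v →
    crossCov P (zProc μ p r w t) (zProc μ p r (σ :: v) t) = 0
  covariance : ∀ (v : List (Fin d)) (σ : Fin d) (t : ℤ), AdmWord 𝓔 (σ :: v) →
    crossCov P (zProc μ p r (σ :: v) t) (zProc μ p r (σ :: v) t) =
      crossCov P (zProc μ p r [σ] t) (zProc μ p r [σ] t)
  nonsingular : ∀ (σ : Fin d) (t : ℤ),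
    IsUnit (crossCov P (zProc μ p r [σ] t) (zProc μ p r [σ] t))

/-! ### Stationary generalized linear switched systems -/

/-- Matrices, noise and state of a generalized linear switched system; `nx` is its dimension. -/
structure GLSS (Ω : Type*) (d nx nn nu ny : ℕ) where
  A : Fin d → Matrix (Fin nx) (Fin nx) ℝ
  B : Fin d → Matrix (Fin nx) (Fin nu) ℝ
  K : Fin d → Matrix (Fin nx) (Fin nn) ℝ
  C : Matrix (Fin ny) (Fin nx) ℝ
  D : Matrix (Fin ny) (Fin nu) ℝ
  F : Matrix (Fin ny) (Fin nn) ℝ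
  v : Proc Ω (Fin nn)
  x : Proc Ω (Fin nx)

/-- `S` is a stationary GLSS of `(y, u, μ)`. -/
structure IsSGLSS {Ω : Type*} [MeasurableSpace Ω] (P : Measure Ω) {d nx nn nu ny : ℕ}
    (μ : Proc Ω (Fin d)) (𝓔 : Set (Fin d × Fin d)) (p : Fin d → ℝ)
    (y : Proc Ω (Fin ny)) (u : Proc Ω (Fin nu)) (S : GLSS Ω d nx nn nu ny) : Prop where
  state_eq : ∀ t, ∀ᵐ ω ∂P, S.x (t + 1) ω =
    ∑ i, μ t ω i • (S.A i *ᵥ S.x t ω + S.B i *ᵥ u t ω + S.K i *ᵥ S.v t ω)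
  output_eq : ∀ t, ∀ᵐ ω ∂P, y t ω = S.C *ᵥ S.x t ω + S.D *ᵥ u t ω + S.F *ᵥ S.v t ω
  whiteNoise : IsWhiteNoise P μ 𝓔 p (stack S.v u)
  noise_input : ∀ σ t, crossCov P (zProc μ p S.v [σ] t) (zProc μ p u [σ] t) = 0
  zmwssi : IsZMWSSI P μ p (stack S.x (stack S.v u))
  state_noise : ∀ σ t,
    crossCov P (zProc μ p S.x [σ] t) (zProc μ p (stack S.v u) [σ] t) = 0
  noise_past_state : ∀ w t, w ≠ [] →
    crossCov P (stack S.v u t) (zProc μ p S.x w t) = 0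
  stable : ∀ z ∈ spectrum ℂ ((∑ σ, p σ • (S.A σ ⊗ₖ S.A σ)).map (algebraMap ℝ ℂ)), ‖z‖ < 1
  compatible : ∀ σ₁ σ₂, (σ₁, σ₂) ∉ 𝓔 → S.A σ₂ * S.A σ₁ = 0 ∧
    ∀ t, S.A σ₂ * Matrix.fromCols (S.K σ₁) (S.B σ₁) *
      crossCov P (zProc μ p (stack S.v u) [σ₁] t) (zProc μ p (stack S.v u) [σ₁] t) = 0

/-! ### Orthogonal projection and the stochastic part -/

/-- The closed subspace of `L²` generated by the (square integrable) random variables in `G`. -/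
def closedSpan {Ω : Type*} [MeasurableSpace Ω] (P : Measure Ω) (G : Set (Ω → ℝ)) :
    Submodule ℝ (Lp ℝ 2 P) :=
  (Submodule.span ℝ {f : Lp ℝ 2 P | ∃ g ∈ G, f =ᵐ[P] g}).topologicalClosure

open Classical in
/-- `E_l[f | G]`: the orthogonal projection of the square integrable variable `f` onto the closed
subspace generated by `G` (a representative; `0` if `f` is not square integrable). -/
def linProj {Ω : Type*} [MeasurableSpace Ω] (P : Measure Ω) (G : Set (Ω → ℝ)) (f : Ω → ℝ) :
    Ω → ℝ :=
  haveI : CompleteSpace (closedSpan P G) :=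
    (Submodule.isClosed_topologicalClosure _).completeSpace_coe
  if h : MemLp f 2 P then ((closedSpan P G).starProjection (h.toLp f) : Lp ℝ 2 P) else 0

/-- The coordinates of `u(t)` and of `z^u_w(t)`, `w` nonempty (the empty word gives `u(t)`). -/
def inputVars {Ω : Type*} {d nu : ℕ} (μ : Proc Ω (Fin d)) (p : Fin d → ℝ)
    (u : Proc Ω (Fin nu)) (t : ℤ) : Set (Ω → ℝ) :=
  {g | ∃ (w : List (Fin d)) (i : Fin nu), g = fun ω => zProc μ p u w t ω i}

/-- Matrices, noise and state of a generalized bilinear system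
`x(t+1) = ∑ (A_σ x(t) + K_σ v(t)) μ_σ(t)`, `y(t) = C x(t) + F v(t)`. -/
structure GBS (Ω : Type*) (d nx nn ny : ℕ) where
  A : Fin d → Matrix (Fin nx) (Fin nx) ℝ
  K : Fin d → Matrix (Fin nx) (Fin nn) ℝ
  C : Matrix (Fin ny) (Fin nx) ℝ
  F : Matrix (Fin ny) (Fin nn) ℝ
  v : Proc Ω (Fin nn)
  x : Proc Ω (Fin nx)

/-- The stochastic part `({A_σ, K_σ}, C, F, v)` of a GLSS; its state is
`x(t) - E_l[x(t) | {z^u_w(t)} ∪ {u(t)}]`. -/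
def GLSS.stochasticPart {Ω : Type*} [MeasurableSpace Ω] {d nx nn nu ny : ℕ}
    (S : GLSS Ω d nx nn nu ny) (P : Measure Ω) (μ : Proc Ω (Fin d)) (p : Fin d → ℝ)
    (u : Proc Ω (Fin nu)) : GBS Ω d nx nn ny where
  A := S.A
  K := S.K
  C := S.C
  F := S.F
  v := S.v
  x := fun t ω i => S.x t ω i - linProj P (inputVars μ p u t) (fun ω' => S.x t ω' i) ω

/-- `G_σ = √p_σ (A_σ P_σ Cᵀ + K_σ Q_σ Fᵀ)` with `P_σ = E[z^x_σ(t) z^x_σ(t)ᵀ]` and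
`Q_σ = E[z^v_σ(t) z^v_σ(t)ᵀ]`. By stationarity the time is immaterial; we take `t = 0`. -/
def GBS.G {Ω : Type*} [MeasurableSpace Ω] {d nx nn ny : ℕ} (S : GBS Ω d nx nn ny)
    (P : Measure Ω) (μ : Proc Ω (Fin d)) (p : Fin d → ℝ) (σ : Fin d) :
    Matrix (Fin nx) (Fin ny) ℝ :=
  √(p σ) •
    (S.A σ * crossCov P (zProc μ p S.x [σ] 0) (zProc μ p S.x [σ] 0) * S.C.transpose
      + S.K σ * crossCov P (zProc μ p S.v [σ] 0) (zProc μ p S.v [σ] 0) * S.F.transpose)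

/-- Reachability of a stationary GBS: the columns of all `A_w G_σ` span the state space. -/
def GBS.Reachable {Ω : Type*} [MeasurableSpace Ω] {d nx nn ny : ℕ} (S : GBS Ω d nx nn ny)
    (P : Measure Ω) (μ : Proc Ω (Fin d)) (p : Fin d → ℝ) : Prop :=
  Submodule.span ℝ {b : Fin nx → ℝ | ∃ (w : List (Fin d)) (σ : Fin d) (j : Fin ny),
    b = (matWord S.A w * S.G P μ p σ).col j} = ⊤

/-- Observability of a stationary GBS: the intersection of the kernels of all `C A_w` is zero. -/
def GBS.Observable {Ω : Type*} {d nx nn ny : ℕ} (S : GBS Ω d nx nn ny) : Prop :=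
  ∀ ξ : Fin nx → ℝ, (∀ w : List (Fin d), (S.C * matWord S.A w) *ᵥ ξ = 0) → ξ = 0

end SwitchedStoch

end

/-! Subtracting from `y(t)` its projection on the space spanned by `u(t)` and all `z^u_w(t)` gives a
process built from `(y, u, μ)` alone, so its covariances are common to all systems with these data.
They determine the Markov parameters `C A_v G_σ` of the stochastic part (`markov_eq`). The Hankel
argument of `dim_le_of_markov_eq` concludes: the map from formal combinations of columns to output
families factors through both state spaces, and through that of an observable and reachable
representation it has rank equal to the dimension.

Removing the projection turns `S` into its stochastic part (`residual_step`, `residual_output`). In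
one step of the dynamics, what comes from `u` and from the projected state stays in the input space,
while what comes from the residual state and the noise is orthogonal to it. Correlating the residual
state at time `|v|` with the past of the residual output along `σv` then peels off one matrix per
letter, since the noise is orthogonal to that past. What remains at time `0` is `G_σ`
(`crossCov_residual_past`). This treats words whose transitions are all allowed; for the others `A_v
G_σ` vanishes by the compatibility condition (`matWord_mul_G_eq_zero`).

The analytic difficulty is multiplication by `μ_σ(t)`, which is not assumed bounded. Given the past,
`μ_σ μ_σ'` has mean zero for distinct letters, and `μ_σ²` has mean `p_σ g` with `g` valued in `{0,
1}` and equal to `1` wherever a preceding letter that may be followed by `σ` is nonzero. Conditional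
independence carries this from the past of the switching to the joint history with state, noise and
input (`switchFiltration_history`). Multiplication by `μ_σ(t)` is therefore bounded on square
integrable functions of the history (`eLpNorm_mul_letter_le`), acts well on closed spans
(`inClosedSpan_mul_letter`), and scales covariances by `p_σ` along allowed transitions
(`crossCov_gate_zProc`). -/

noncomputable section

set_option linter.unusedSectionVars false

namespace SwitchedStoch

/-! ### Conditional independence and enlargement of the conditioning σ-algebra. -/

section CondExp

lemma sup_eq_generateFrom_inter {Ω : Type*} {m m₁ : MeasurableSpace Ω} :
    m₁ ⊔ m = MeasurableSpace.generateFrom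
      {s | ∃ s₁ s₀, MeasurableSet[m₁] s₁ ∧ MeasurableSet[m] s₀ ∧ s = s₁ ∩ s₀} := by
  apply le_antisymm
  · refine sup_le (fun s hs => ?_) (fun s hs => ?_)
    · exact MeasurableSpace.measurableSet_generateFrom
        ⟨s, Set.univ, hs, MeasurableSet.univ, by simp⟩
    · exact MeasurableSpace.measurableSet_generateFrom
        ⟨Set.univ, s, MeasurableSet.univ, hs, by simp⟩
  · refine MeasurableSpace.generateFrom_le ?_
    rintro _ ⟨s₁, s₀, h₁, h₀, rfl⟩
    exact MeasurableSet.inter (m := m₁ ⊔ m) ((le_sup_left : m₁ ≤ m₁ ⊔ m) _ h₁)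
      ((le_sup_right : m ≤ m₁ ⊔ m) _ h₀)

variable {Ω : Type*} {m m₁ m₂ : MeasurableSpace Ω} [mΩ : MeasurableSpace Ω] {P : Measure Ω}
  [IsProbabilityMeasure P]

/-- Tower property for a product with an `m`-measurable factor. -/
lemma integral_mul_condExp (hm : m ≤ mΩ) {f g : Ω → ℝ} (hf : AEStronglyMeasurable[m] f P)
    (hfg : Integrable (f * g) P) (hg : Integrable g P) :
    ∫ ω, f ω * (P[g | m]) ω ∂P = ∫ ω, f ω * g ω ∂P := by
  rw [← integral_condExp hm (f := fun ω => f ω * g ω)]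
  exact integral_congr_ae (condExp_mul_of_aestronglyMeasurable_left hf hfg hg).symm

lemma setIntegral_mul_condExp_left (hm : m ≤ mΩ) {f g : Ω → ℝ} {s : Set Ω}
    (hs : MeasurableSet[m] s) (hf : AEStronglyMeasurable[m] f P)
    (hfg : Integrable (f * g) P) (hg : Integrable g P) :
    ∫ ω in s, f ω * (P[g | m]) ω ∂P = ∫ ω in s, f ω * g ω ∂P := by
  rw [← setIntegral_condExp hm (f := fun ω => f ω * g ω) hfg hs]
  refine setIntegral_congr_ae (hm _ hs) ?_
  filter_upwards [condExp_mul_of_aestronglyMeasurable_left hf hfg hg] with ω h _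
  exact h.symm

/-- Tested on `m₂`-sets, conditional independence says that `φ - E[φ | m]`, with `φ` the indicator
of `s₁`, has zero conditional mean given `m₂` after restriction to `s₀`. It is thus orthogonal to
`W`, and self-adjointness of conditional expectation moves the conditioning from `φ` to `W`.
Boundedness of `φ` makes integrability of `W` sufficient. -/
lemma setIntegral_condExp_inter (hm : m ≤ mΩ) (hm₁ : m₁ ≤ mΩ) (hm₂ : m₂ ≤ mΩ)
    (h : CondIndepGiven P m m₁ m₂) {W : Ω → ℝ} (hW : StronglyMeasurable[m₂] W)
    (hWi : Integrable W P) {s₁ s₀ : Set Ω} (hs₁ : MeasurableSet[m₁] s₁)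
    (hs₀ : MeasurableSet[m] s₀) :
    ∫ ω in s₁ ∩ s₀, (P[W | m]) ω ∂P = ∫ ω in s₁ ∩ s₀, W ω ∂P := by
  set φ : Ω → ℝ := s₁.indicator (fun _ => (1 : ℝ)) with hφ
  have hφi : Integrable φ P := (integrable_const 1).indicator (hm₁ _ hs₁)
  have hφb : ∀ᵐ ω ∂P, |φ ω| ≤ 1 := by
    filter_upwards with ω
    by_cases hω : ω ∈ s₁ <;> simp [φ, hω]
  have hEb := ae_bdd_abs_condExp_of_ae_bdd_abs (m := m) hφb
  have hEmeas : AEStronglyMeasurable[m] (P[φ | m]) P :=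
    stronglyMeasurable_condExp.aestronglyMeasurable
  have mulE : ∀ {g : Ω → ℝ}, Integrable g P → Integrable (fun ω => (P[φ | m]) ω * g ω) P :=
    fun hg => hg.bdd_mul (hEmeas.mono hm) hEb
  have mulφ : ∀ {g : Ω → ℝ}, Integrable g P → Integrable (fun ω => φ ω * g ω) P :=
    fun hg => hg.bdd_mul hφi.aestronglyMeasurable hφb
  have key : ∫ ω, s₀.indicator (φ - P[φ | m]) ω * W ω ∂P = 0 := by
    have hYi : Integrable (s₀.indicator (φ - P[φ | m])) P :=
      (hφi.sub integrable_condExp).indicator (hm _ hs₀)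
    have hY0 : (0 : Ω → ℝ) =ᵐ[P] P[s₀.indicator (φ - P[φ | m]) | m₂] := by
      refine ae_eq_condExp_of_forall_setIntegral_eq hm₂ hYi
        (fun _ _ _ => (integrable_zero _ _ _).integrableOn) (fun s₂ hs₂ _ => ?_)
        aestronglyMeasurable_zero
      have hs₂i : Integrable (s₂.indicator (fun _ => (1 : ℝ))) P :=
        (integrable_const 1).indicator (hm₂ _ hs₂)
      have e1 : ∫ ω in s₀, φ ω * s₂.indicator (fun _ => (1 : ℝ)) ω ∂P =
          ∫ ω in s₀, (P[φ | m]) ω * s₂.indicator (fun _ => (1 : ℝ)) ω ∂P := by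
        rw [← setIntegral_mul_condExp_left hm hs₀ hEmeas (mulE hs₂i) hs₂i]
        have : (fun ω => φ ω * s₂.indicator (fun _ => (1 : ℝ)) ω) =
            (s₁ ∩ s₂).indicator (fun _ => (1 : ℝ)) := by
          ext ω
          by_cases h1 : ω ∈ s₁ <;> by_cases h2 : ω ∈ s₂ <;> simp [φ, h1, h2]
        rw [this, ← setIntegral_condExp hm ((integrable_const 1).indicator
          ((hm₁ _ hs₁).inter (hm₂ _ hs₂))) hs₀]
        refine setIntegral_congr_ae (hm _ hs₀) ?_
        filter_upwards [h s₁ s₂ hs₁ hs₂] with ω hω _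
        exact hω
      have e2 : ∫ ω in s₂, s₀.indicator (φ - P[φ | m]) ω ∂P =
          ∫ ω in s₀, (φ ω * s₂.indicator (fun _ => (1 : ℝ)) ω -
            (P[φ | m]) ω * s₂.indicator (fun _ => (1 : ℝ)) ω) ∂P := by
        rw [← integral_indicator (hm₂ _ hs₂), ← integral_indicator (hm _ hs₀)]
        congr 1
        ext ω
        by_cases h0 : ω ∈ s₀ <;> by_cases h2 : ω ∈ s₂ <;> simp [h0, h2]
      rw [e2]
      rw [integral_sub (mulφ hs₂i).integrableOn (mulE hs₂i).integrableOn, e1]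
      simp
    have hYW : Integrable (s₀.indicator (φ - P[φ | m]) * W) P := by
      have : s₀.indicator (φ - P[φ | m]) * W = s₀.indicator (φ * W - P[φ | m] * W) := by
        ext ω
        by_cases h0 : ω ∈ s₀ <;> simp [h0, sub_mul]
      rw [this]
      exact ((mulφ hWi).sub (mulE hWi)).indicator (hm _ hs₀)
    have := integral_mul_condExp hm₂ hW.aestronglyMeasurable (by rwa [mul_comm]) hYi
    rw [show (fun ω => s₀.indicator (φ - P[φ | m]) ω * W ω) =
      fun ω => W ω * s₀.indicator (φ - P[φ | m]) ω from funext fun _ => mul_comm _ _, ← this]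
    refine (integral_congr_ae ?_).trans (integral_zero _ _)
    filter_upwards [hY0] with ω hω
    simp [← hω]
  have e3 : ∫ ω in s₀, φ ω * W ω ∂P = ∫ ω in s₀, (P[φ | m]) ω * W ω ∂P := by
    rw [← sub_eq_zero, ← integral_sub (mulφ hWi).integrableOn (mulE hWi).integrableOn, ← key,
      ← integral_indicator (hm _ hs₀)]
    congr 1
    ext ω
    by_cases h0 : ω ∈ s₀ <;> simp [h0, sub_mul]
  have e4 : ∀ g : Ω → ℝ, ∫ ω in s₁ ∩ s₀, g ω ∂P = ∫ ω in s₀, φ ω * g ω ∂P := by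
    intro g
    rw [← integral_indicator ((hm₁ _ hs₁).inter (hm _ hs₀)), ← integral_indicator (hm _ hs₀)]
    congr 1
    ext ω
    by_cases h0 : ω ∈ s₀ <;> by_cases h1 : ω ∈ s₁ <;> simp [φ, h0, h1]
  rw [e4, e4, e3, ← setIntegral_mul_condExp_left hm hs₀ hEmeas (mulE hWi) hWi]
  have := setIntegral_mul_condExp_left (f := P[W | m]) (g := φ) hm hs₀
    stronglyMeasurable_condExp.aestronglyMeasurable
    (by rw [mul_comm]; exact mulφ integrable_condExp) hφi
  simp_rw [mul_comm (P[φ | m] _), mul_comm (φ _)]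
  exact this.symm

/-- If `m₁` and `m₂` are conditionally independent given `m`, then enlarging `m` by `m₁` does not
change the conditional expectation of an `m₂`-measurable variable. -/
lemma condExp_sup_of_condIndepGiven (hm : m ≤ mΩ) (hm₁ : m₁ ≤ mΩ) (hm₂ : m₂ ≤ mΩ)
    (h : CondIndepGiven P m m₁ m₂) {W : Ω → ℝ} (hW : StronglyMeasurable[m₂] W)
    (hWi : Integrable W P) : P[W | m₁ ⊔ m] =ᵐ[P] P[W | m] := by
  have hsup : m₁ ⊔ m ≤ mΩ := sup_le hm₁ hm
  symm
  refine ae_eq_condExp_of_forall_setIntegral_eq hsup hWi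
    (fun _ _ _ => integrable_condExp.integrableOn) (fun s hs _ => ?_)
    ((stronglyMeasurable_condExp (m := m)).aestronglyMeasurable.mono le_sup_right)
  induction s, hs using MeasurableSpace.induction_on_inter sup_eq_generateFrom_inter with
  | h_inter =>
    rintro _ ⟨a, b, ha, hb, rfl⟩ _ ⟨a', b', ha', hb', rfl⟩ _
    exact ⟨a ∩ a', b ∩ b', MeasurableSet.inter ha ha', MeasurableSet.inter hb hb',
      Set.inter_inter_inter_comm _ _ _ _⟩
  | empty => simp
  | basic s hs =>
    obtain ⟨a, b, ha, hb, rfl⟩ := hs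
    exact setIntegral_condExp_inter hm hm₁ hm₂ h hW hWi ha hb
  | compl s hs ih =>
    have e1 := integral_add_compl (hsup _ hs) (integrable_condExp (μ := P) (m := m) (f := W))
    have e2 := integral_add_compl (hsup _ hs) hWi
    rw [integral_condExp hm] at e1
    have := ih (measure_lt_top _ _)
    linarith
  | iUnion f hd hf ih =>
    rw [integral_iUnion (fun i => hsup _ (hf i)) hd integrable_condExp.integrableOn,
      integral_iUnion (fun i => hsup _ (hf i)) hd hWi.integrableOn]
    exact tsum_congr fun i => ih i (measure_lt_top _ _)

end CondExp

/-! ### Conditional second moments of the switching process. -/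

section Filtration

variable {Ω : Type*} [mΩ : MeasurableSpace Ω] {P : Measure Ω} [IsProbabilityMeasure P]
  {d : ℕ} {μ : Proc Ω (Fin d)} {𝓔 : Set (Fin d × Fin d)} {p : Fin d → ℝ}

lemma IsAdmissible.memLp_letter (hμ : IsAdmissible P μ 𝓔 p) (σ : Fin d) (t : ℤ) :
    MemLp (fun ω => μ t ω σ) 2 P := by
  have := (hμ.stationary [σ] [σ] (by simp) (by simp)).memLp 0 t
  simpa [switchWord] using this

lemma IsAdmissible.memLp_pair (hμ : IsAdmissible P μ 𝓔 p) (τ σ : Fin d) (t : ℤ) :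
    MemLp (fun ω => μ (t - 1) ω τ * μ t ω σ) 2 P := by
  have := (hμ.stationary [τ, σ] [σ] (by simp) (by simp)).memLp 0 t
  simpa [switchWord] using this

lemma admWord_pair {τ σ : Fin d} : AdmWord 𝓔 [τ, σ] ↔ (τ, σ) ∈ 𝓔 := by
  simp [AdmWord]

lemma IsAdmissible.pair_eq_zero (hμ : IsAdmissible P μ 𝓔 p) {τ σ : Fin d} (h : (τ, σ) ∉ 𝓔)
    (t : ℤ) : ∀ᵐ ω ∂P, μ (t - 1) ω τ * μ t ω σ = 0 := by
  filter_upwards [hμ.eq_zero [τ, σ] (by simp) (by rwa [admWord_pair]) t] with ω hω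
  simpa [switchWord] using hω

lemma measurable_sigmaGen {ι : Type*} (r : Proc Ω ι) {T : Set ℤ} {k : ℤ} (hk : k ∈ T) (i : ι) :
    Measurable[sigmaGen r T] (fun ω => r k ω i) := by
  have h1 : Measurable[sigmaGen r T] (r k) :=
    Measurable.mono (comap_measurable (r k)) (le_iSup₂_of_le k hk le_rfl) le_rfl
  exact (measurable_pi_apply i).comp h1

lemma sigmaGen_le {ι : Type*} {r : Proc Ω ι} (hr : ∀ t, Measurable (r t)) (T : Set ℤ) :
    sigmaGen r T ≤ mΩ :=
  iSup₂_le fun k _ => (hr k).comap_le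

lemma sigmaGen_mono {Ω ι : Type*} (r : Proc Ω ι) {T T' : Set ℤ} (h : T ⊆ T') :
    sigmaGen r T ≤ sigmaGen r T' :=
  iSup₂_le fun k hk => le_iSup₂_of_le k (h hk) le_rfl

open Classical in
/-- The indicator (up to null sets) that the letter at time `t - 1` may be followed by `σ`. -/
def admissibleInd (μ : Proc Ω (Fin d)) (𝓔 : Set (Fin d × Fin d)) (α : Fin d → ℝ) (σ : Fin d)
    (t : ℤ) (ω : Ω) : ℝ :=
  ∑ τ, if (τ, σ) ∈ 𝓔 then α τ * μ (t - 1) ω τ else 0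

lemma measurable_admissibleInd (α : Fin d → ℝ) (σ : Fin d) (t : ℤ) :
    Measurable[sigmaGen μ (Set.Iio t)] (admissibleInd μ 𝓔 α σ t) := by
  classical
  unfold admissibleInd
  refine Finset.measurable_fun_sum _ fun τ _ => ?_
  split_ifs
  · exact (measurable_sigmaGen μ (by simp) τ).const_mul _
  · exact measurable_const

lemma IsAdmissible.condExp_triple (hμ : IsAdmissible P μ 𝓔 p) (τ σ : Fin d) (t : ℤ)
    [Decidable ((τ, σ) ∈ 𝓔)] :
    P[fun ω => μ (t - 1) ω τ * μ t ω σ * μ t ω σ | sigmaGen μ (Set.Iio t)] =ᵐ[P]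
      fun ω => if (τ, σ) ∈ 𝓔 then p σ * μ (t - 1) ω τ else 0 := by
  split_ifs with h
  · simpa [switchWord] using
      hμ.cond_letter_same [τ] σ t (by simp) (by simpa using admWord_pair.2 h)
  · have := hμ.cond_letter_diff [τ] σ σ t (by simp)
      (by simpa using fun h' => h (admWord_pair.1 h'))
    simpa [switchWord, Pi.zero_def] using this

/-- Admissibility prescribes no conditional mean for the square of a single letter. Inserting `1 = ∑
α_τ μ_τ(t-1)` writes the square as a combination of two-letter words times a letter, which it does
cover. -/
lemma IsAdmissible.condExp_sq (hμ : IsAdmissible P μ 𝓔 p) {α : Fin d → ℝ}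
    (hα : ∀ t, ∀ᵐ ω ∂P, ∑ σ, α σ * μ t ω σ = 1) (σ : Fin d) (t : ℤ) :
    P[fun ω => μ t ω σ * μ t ω σ | sigmaGen μ (Set.Iio t)] =ᵐ[P]
      fun ω => p σ * admissibleInd μ 𝓔 α σ t ω := by
  classical
  have hm := sigmaGen_le hμ.measurable (Set.Iio t)
  have hi : ∀ τ, Integrable (fun ω => μ (t - 1) ω τ * μ t ω σ * μ t ω σ) P := fun τ =>
    (hμ.memLp_pair τ σ t).integrable_mul (hμ.memLp_letter σ t)
  have e1 : (fun ω => μ t ω σ * μ t ω σ) =ᵐ[P]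
      ∑ τ, α τ • fun ω => μ (t - 1) ω τ * μ t ω σ * μ t ω σ := by
    filter_upwards [hα (t - 1)] with ω hω
    simp only [Finset.sum_apply, Pi.smul_apply, smul_eq_mul]
    simp_rw [← mul_assoc, ← Finset.sum_mul]
    rw [hω, one_mul]
  refine (condExp_congr_ae e1).trans ?_
  refine (condExp_finsetSum (fun τ _ => (hi τ).smul (α τ)) _).trans ?_
  have e2 : ∀ᵐ ω ∂P, ∀ τ, (P[α τ • fun ω => μ (t - 1) ω τ * μ t ω σ * μ t ω σ |
      sigmaGen μ (Set.Iio t)]) ω = α τ * (if (τ, σ) ∈ 𝓔 then p σ * μ (t - 1) ω τ else 0) := by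
    rw [ae_all_iff]
    intro τ
    filter_upwards [condExp_smul (α τ) (fun ω => μ (t - 1) ω τ * μ t ω σ * μ t ω σ)
      (sigmaGen μ (Set.Iio t)) (μ := P), hμ.condExp_triple τ σ t] with ω h1 h2
    rw [h1, Pi.smul_apply, h2, smul_eq_mul]
  filter_upwards [e2] with ω h
  simp only [Finset.sum_apply, h, admissibleInd, Finset.mul_sum]
  refine Finset.sum_congr rfl fun τ _ => ?_
  split_ifs <;> ring

/-- The terms left out of the indicator are forbidden transitions, which vanish after multiplication
by `μ_σ(t)`; restoring them completes the sum to `1`. -/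
lemma IsAdmissible.admissibleInd_mul_letter (hμ : IsAdmissible P μ 𝓔 p) {α : Fin d → ℝ}
    (hα : ∀ t, ∀ᵐ ω ∂P, ∑ σ, α σ * μ t ω σ = 1) (σ : Fin d) (t : ℤ) :
    ∀ᵐ ω ∂P, admissibleInd μ 𝓔 α σ t ω * μ t ω σ = μ t ω σ := by
  classical
  have h0 : ∀ᵐ ω ∂P, ∀ τ, (τ, σ) ∉ 𝓔 → μ (t - 1) ω τ * μ t ω σ = 0 := by
    rw [ae_all_iff]
    intro τ
    by_cases h : (τ, σ) ∈ 𝓔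
    · simp [h]
    · filter_upwards [hμ.pair_eq_zero h t] with ω hω _ using hω
  filter_upwards [h0, hα (t - 1)] with ω h1 h2
  conv_rhs => rw [← one_mul (μ t ω σ), ← h2]
  rw [admissibleInd, Finset.sum_mul, Finset.sum_mul]
  refine Finset.sum_congr rfl fun τ _ => ?_
  split_ifs with h
  · rfl
  · rw [mul_assoc, h1 τ h]; simp

/-- With `g` the indicator, `(1 - g) μ_σ² = 0`. Conditioning on the past turns this into `(1 - g)
p_σ g = 0`, and `p_σ` is positive. -/
lemma IsAdmissible.admissibleInd_zero_or_one (hμ : IsAdmissible P μ 𝓔 p) {α : Fin d → ℝ}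
    (hα : ∀ t, ∀ᵐ ω ∂P, ∑ σ, α σ * μ t ω σ = 1) (σ : Fin d) (t : ℤ) :
    ∀ᵐ ω ∂P, admissibleInd μ 𝓔 α σ t ω = 0 ∨ admissibleInd μ 𝓔 α σ t ω = 1 := by
  have hz : (fun ω => 1 - admissibleInd μ 𝓔 α σ t ω) * (fun ω => μ t ω σ * μ t ω σ) =ᵐ[P]
      0 := by
    filter_upwards [hμ.admissibleInd_mul_letter hα σ t] with ω hω
    simp only [Pi.mul_apply, Pi.zero_apply]
    rw [← mul_assoc, sub_mul, hω]
    ring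
  have := condExp_mul_of_stronglyMeasurable_left (μ := P)
    (((measurable_admissibleInd (𝓔 := 𝓔) α σ t).const_sub 1).stronglyMeasurable)
    ((integrable_congr hz).2 (integrable_zero _ _ _))
    ((hμ.memLp_letter σ t).integrable_mul (hμ.memLp_letter σ t))
  have h0 := condExp_congr_ae (m := sigmaGen μ (Set.Iio t)) hz
  rw [condExp_zero] at h0
  filter_upwards [this, h0, hμ.condExp_sq hα σ t] with ω h1 h2 h3
  have h4 := h1.symm.trans h2
  simp only [Pi.mul_apply, Pi.zero_apply] at h4
  have h5 : (1 - admissibleInd μ 𝓔 α σ t ω) * (p σ * admissibleInd μ 𝓔 α σ t ω) = 0 := by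
    rw [← h3]; exact h4
  rcases mul_eq_zero.1 h5 with h | h
  · right; linarith
  · left; exact (mul_eq_zero.1 h).resolve_left (hμ.p_pos σ).ne'

/-- The conditional mean of `μ_τ(t-1) μ_σ(t)²` is computed twice, by pulling out the past letter and
by admissibility; cancelling `p_σ` compares the results. -/
lemma IsAdmissible.letter_mul_admissibleInd (hμ : IsAdmissible P μ 𝓔 p) {α : Fin d → ℝ}
    (hα : ∀ t, ∀ᵐ ω ∂P, ∑ σ, α σ * μ t ω σ = 1) {τ σ : Fin d} (h : (τ, σ) ∈ 𝓔) (t : ℤ) :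
    ∀ᵐ ω ∂P, μ (t - 1) ω τ * admissibleInd μ 𝓔 α σ t ω = μ (t - 1) ω τ := by
  classical
  have hi : Integrable ((fun ω => μ (t - 1) ω τ) * (fun ω => μ t ω σ * μ t ω σ)) P :=
    ((hμ.memLp_pair τ σ t).integrable_mul (hμ.memLp_letter σ t)).congr
      (by filter_upwards with ω; simp [mul_assoc])
  have := condExp_mul_of_stronglyMeasurable_left (μ := P)
    ((measurable_sigmaGen μ (T := Set.Iio t) (k := t - 1) (by simp) τ).stronglyMeasurable) hi
    ((hμ.memLp_letter σ t).integrable_mul (hμ.memLp_letter σ t))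
  have h' := hμ.condExp_triple τ σ t
  have e : (fun ω => μ (t - 1) ω τ * μ t ω σ * μ t ω σ) =
    (fun ω => μ (t - 1) ω τ) * (fun ω => μ t ω σ * μ t ω σ) := by
    ext ω; simp [mul_assoc]
  rw [e] at h'
  filter_upwards [this, h', hμ.condExp_sq hα σ t] with ω h1 h2 h3
  have h4 := h1.symm.trans h2
  simp only [h, if_true, Pi.mul_apply] at h4
  have h5 : μ (t - 1) ω τ * (p σ * admissibleInd μ 𝓔 α σ t ω) = p σ * μ (t - 1) ω τ := by
    rw [← h3]; exact h4
  have := (hμ.p_pos σ).ne'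
  apply mul_left_cancel₀ this
  linarith

/-- `m` is a filtration for which the second conditional moments of the switching process are
those prescribed by admissibility. -/
structure SwitchFiltration (P : Measure Ω) (μ : Proc Ω (Fin d)) (𝓔 : Set (Fin d × Fin d))
    (p : Fin d → ℝ) (m : ℤ → MeasurableSpace Ω) : Prop where
  le : ∀ t, m t ≤ mΩ
  measurable_letter : ∀ t σ, Measurable[m t] (fun ω => μ (t - 1) ω σ)
  mono : ∀ t, m (t - 1) ≤ m t
  memLp_letter : ∀ σ t, MemLp (fun ω => μ t ω σ) 2 P
  p_pos : ∀ σ, 0 < p σ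
  condExp_ne : ∀ σ σ' t, σ ≠ σ' → P[fun ω => μ t ω σ * μ t ω σ' | m t] =ᵐ[P] 0
  condExp_sq : ∀ σ t, ∃ g : Ω → ℝ, Measurable[m t] g ∧ (∀ᵐ ω ∂P, g ω = 0 ∨ g ω = 1) ∧
    (P[fun ω => μ t ω σ * μ t ω σ | m t] =ᵐ[P] fun ω => p σ * g ω) ∧
    ∀ τ, (τ, σ) ∈ 𝓔 → ∀ᵐ ω ∂P, μ (t - 1) ω τ * g ω = μ (t - 1) ω τ
  pair_eq_zero : ∀ τ σ t, (τ, σ) ∉ 𝓔 → ∀ᵐ ω ∂P, μ (t - 1) ω τ * μ t ω σ = 0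

/-- The history of `r` up to time `t` together with the strict past of the switching. -/
abbrev history {ι : Type*} (μ : Proc Ω (Fin d)) (r : Proc Ω ι) (t : ℤ) : MeasurableSpace Ω :=
  sigmaGen r (Set.Iic t) ⊔ sigmaGen μ (Set.Iio t)

lemma switchFiltration_history {ι : Type*} (hμ : IsAdmissible P μ 𝓔 p) {r : Proc Ω ι}
    (hr : IsZMWSSI P μ p r) : SwitchFiltration P μ 𝓔 p (history μ r) := by
  have hcond : ∀ σ σ' t, P[fun ω => μ t ω σ * μ t ω σ' | history μ r t] =ᵐ[P]
      P[fun ω => μ t ω σ * μ t ω σ' | sigmaGen μ (Set.Iio t)] := fun σ σ' t =>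
    condExp_sup_of_condIndepGiven (sigmaGen_le hμ.measurable _) (sigmaGen_le hr.measurable _)
      (sigmaGen_le hμ.measurable (Set.Ici t)) (hr.condIndep t)
      (((measurable_sigmaGen μ (by simp) σ).mul
        (measurable_sigmaGen μ (by simp) σ')).stronglyMeasurable)
      ((hμ.memLp_letter σ t).integrable_mul (hμ.memLp_letter σ' t))
  refine ⟨fun t => sup_le (sigmaGen_le hr.measurable _) (sigmaGen_le hμ.measurable _),
    fun t σ => ?_, fun t => ?_, hμ.memLp_letter, hμ.p_pos, fun σ σ' t h => ?_, fun σ t => ?_,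
    fun τ σ t h => hμ.pair_eq_zero h t⟩
  · exact Measurable.mono (measurable_sigmaGen μ (T := Set.Iio t) (by simp) σ)
      le_sup_right le_rfl
  · exact sup_le_sup (sigmaGen_mono _ (Set.Iic_subset_Iic.2 (by lia)))
      (sigmaGen_mono _ (Set.Iio_subset_Iio (by lia)))
  · exact (hcond σ σ' t).trans (hμ.cond_letters σ σ' t h)
  · obtain ⟨α, hα⟩ := hμ.exists_alpha
    exact ⟨admissibleInd μ 𝓔 α σ t,
      Measurable.mono (measurable_admissibleInd α σ t) le_sup_right le_rfl,
      hμ.admissibleInd_zero_or_one hα σ t, (hcond σ σ t).trans (hμ.condExp_sq hα σ t),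
      fun τ h => hμ.letter_mul_admissibleInd hα h t⟩

end Filtration

/-! ### Multiplication by a letter as a bounded operation on `L²`. -/

section Adapted

variable {Ω : Type*} {m₀ : MeasurableSpace Ω} [mΩ : MeasurableSpace Ω] {P : Measure Ω}
  [IsProbabilityMeasure P]
  {d : ℕ} {μ : Proc Ω (Fin d)} {𝓔 : Set (Fin d × Fin d)} {p : Fin d → ℝ}
  {m : ℤ → MeasurableSpace Ω}

/-- `f` is square integrable and almost everywhere equal to an `m`-measurable function. -/
structure AdaptedL2 (P : Measure Ω) (m : MeasurableSpace Ω) (f : Ω → ℝ) : Prop where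
  memLp : MemLp f 2 P
  meas : AEStronglyMeasurable[m] f P

lemma lintegral_sq_eq_eLpNorm_sq (f : Ω → ℝ) :
    ∫⁻ ω, ‖f ω‖ₑ ^ 2 ∂P = eLpNorm f 2 P ^ 2 := by
  have := eLpNorm_nnreal_pow_eq_lintegral (f := f) (p := 2) (μ := P) (by norm_num)
  simpa using this.symm

lemma SwitchFiltration.measurable_letter' (hm : SwitchFiltration P μ 𝓔 p m) (σ : Fin d) (t : ℤ) :
    Measurable (fun ω => μ t ω σ) := by
  have := hm.measurable_letter (t + 1) σ
  rw [add_sub_cancel_right] at this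
  exact this.mono (hm.le _) le_rfl

/-- The measures with densities `a` and `b` agree on `m₀`. Working with nonnegative integrals asks
no integrability of `F`, so the lemma can be used to prove that a product is square integrable. -/
lemma lintegral_mul_ofReal_eq (hm : m₀ ≤ mΩ) {a b : Ω → ℝ}
    (ha : Measurable a) (hb : Measurable b) (hai : Integrable a P) (hbi : Integrable b P)
    (ha0 : 0 ≤ᵐ[P] a) (hb0 : 0 ≤ᵐ[P] b) (hab : P[a | m₀] =ᵐ[P] b)
    {F : Ω → ENNReal} (hF : Measurable[m₀] F) :
    ∫⁻ ω, ENNReal.ofReal (a ω) * F ω ∂P = ∫⁻ ω, ENNReal.ofReal (b ω) * F ω ∂P := by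
  have hF' : Measurable F := hF.mono hm le_rfl
  have e : (P.withDensity fun ω => ENNReal.ofReal (a ω)).trim hm =
      (P.withDensity fun ω => ENNReal.ofReal (b ω)).trim hm := by
    refine @Measure.ext _ m₀ _ _ fun s hs => ?_
    rw [trim_measurableSet_eq hm hs, trim_measurableSet_eq hm hs,
      withDensity_apply _ (hm _ hs), withDensity_apply _ (hm _ hs),
      ← ofReal_integral_eq_lintegral_ofReal hai.integrableOn (ae_restrict_of_ae ha0),
      ← ofReal_integral_eq_lintegral_ofReal hbi.integrableOn (ae_restrict_of_ae hb0),
      ← setIntegral_condExp hm hai hs]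
    congr 1
    refine setIntegral_congr_ae (hm _ hs) ?_
    filter_upwards [hab] with ω h _ using h
  have h1 := lintegral_withDensity_eq_lintegral_mul P ha.ennreal_ofReal hF'
  have h2 := lintegral_withDensity_eq_lintegral_mul P hb.ennreal_ofReal hF'
  simp only [Pi.mul_apply] at h1 h2
  rw [← h1, ← h2, ← lintegral_trim hm hF, ← lintegral_trim hm hF, e]

/-- Conditioning replaces `μ_σ²` by `p_σ g` with `g ≤ 1`. This substitutes for boundedness of the
switching process. -/
lemma SwitchFiltration.eLpNorm_mul_letter_le (hm : SwitchFiltration P μ 𝓔 p m) {f : Ω → ℝ}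
    {t : ℤ} (hf : AEStronglyMeasurable[m t] f P) (σ : Fin d) :
    eLpNorm (fun ω => f ω * μ t ω σ) 2 P ^ 2 ≤ ENNReal.ofReal (p σ) * eLpNorm f 2 P ^ 2 := by
  obtain ⟨f', hf', hff'⟩ := hf
  have e1 : eLpNorm (fun ω => f ω * μ t ω σ) 2 P = eLpNorm (fun ω => f' ω * μ t ω σ) 2 P :=
    eLpNorm_congr_ae (by filter_upwards [hff'] with ω h; rw [h])
  rw [e1, eLpNorm_congr_ae hff', ← lintegral_sq_eq_eLpNorm_sq, ← lintegral_sq_eq_eLpNorm_sq]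
  obtain ⟨g, hg, hg01, hgc, -⟩ := hm.condExp_sq σ t
  have hF : Measurable[m t] (fun ω => ‖f' ω‖ₑ ^ 2) :=
    (measurable_enorm.comp hf'.measurable).pow_const 2
  have hμi : Integrable (fun ω => μ t ω σ * μ t ω σ) P :=
    (hm.memLp_letter σ t).integrable_mul (hm.memLp_letter σ t)
  have hpg : Integrable (fun ω => p σ * g ω) P := integrable_condExp.congr hgc
  have key := lintegral_mul_ofReal_eq (P := P) (hm.le t)
    ((hm.measurable_letter' σ t).mul (hm.measurable_letter' σ t))
    ((hg.mono (hm.le t) le_rfl).const_mul (p σ)) hμi hpg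
    (Filter.Eventually.of_forall fun ω => mul_self_nonneg _)
    (by
      filter_upwards [hg01] with ω h
      have := (hm.p_pos σ).le
      rcases h with h | h <;> simp [h, this]) hgc hF
  calc ∫⁻ ω, ‖f' ω * μ t ω σ‖ₑ ^ 2 ∂P
      = ∫⁻ ω, ENNReal.ofReal (μ t ω σ * μ t ω σ) * ‖f' ω‖ₑ ^ 2 ∂P := by
        refine lintegral_congr fun ω => ?_
        rw [enorm_mul, mul_pow, mul_comm, ← pow_two, ← sq_abs, ENNReal.ofReal_pow (abs_nonneg _),
          Real.enorm_eq_ofReal_abs (μ t ω σ)]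
    _ = ∫⁻ ω, ENNReal.ofReal (p σ * g ω) * ‖f' ω‖ₑ ^ 2 ∂P := key
    _ ≤ ∫⁻ ω, ENNReal.ofReal (p σ) * ‖f' ω‖ₑ ^ 2 ∂P := by
        refine lintegral_mono_ae ?_
        filter_upwards [hg01] with ω h
        gcongr
        have := (hm.p_pos σ).le
        rcases h with h | h <;> simp [h, this]
    _ = _ := lintegral_const_mul' _ _ ENNReal.ofReal_ne_top

lemma SwitchFiltration.memLp_mul_letter (hm : SwitchFiltration P μ 𝓔 p m) {f : Ω → ℝ}
    {t : ℤ} (hf : AdaptedL2 P (m t) f) (σ : Fin d) :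
    MemLp (fun ω => f ω * μ t ω σ) 2 P := by
  refine ⟨hf.memLp.aestronglyMeasurable.mul
    (hm.measurable_letter' σ t).aestronglyMeasurable, ?_⟩
  have h := hm.eLpNorm_mul_letter_le hf.meas σ
  have h2 : eLpNorm (fun ω => f ω * μ t ω σ) 2 P ^ 2 < ⊤ :=
    h.trans_lt (ENNReal.mul_lt_top ENNReal.ofReal_lt_top (ENNReal.pow_lt_top hf.memLp.2))
  exact lt_top_iff_ne_top.2 fun h3 => by simp [h3] at h2

lemma SwitchFiltration.adapted_mul_letter (hm : SwitchFiltration P μ 𝓔 p m) {f : Ω → ℝ}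
    {t : ℤ} (hf : AdaptedL2 P (m (t - 1)) f) (σ : Fin d) :
    AdaptedL2 P (m t) (fun ω => f ω * μ (t - 1) ω σ) :=
  ⟨hm.memLp_mul_letter hf σ, (hf.meas.mono (hm.mono t)).mul
    (hm.measurable_letter t σ).stronglyMeasurable.aestronglyMeasurable⟩

lemma SwitchFiltration.integral_letter_ne (hm : SwitchFiltration P μ 𝓔 p m) {f h : Ω → ℝ}
    {t : ℤ} (hf : AdaptedL2 P (m t) f) (hh : AdaptedL2 P (m t) h) {σ σ' : Fin d}
    (hσ : σ ≠ σ') : ∫ ω, (f ω * μ t ω σ) * (h ω * μ t ω σ') ∂P = 0 := by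
  have hi := (hm.memLp_mul_letter hf σ).integrable_mul (hm.memLp_mul_letter hh σ')
  have e : ∀ ω, (f ω * μ t ω σ) * (h ω * μ t ω σ') = (f * h) ω * (μ t ω σ * μ t ω σ') := by
    intro ω; simp; ring
  have hi' : Integrable ((f * h) * fun ω => μ t ω σ * μ t ω σ') P :=
    hi.congr (Filter.Eventually.of_forall e)
  simp_rw [e]
  rw [← integral_mul_condExp (hm.le t) (hf.meas.mul hh.meas) hi'
    ((hm.memLp_letter σ t).integrable_mul (hm.memLp_letter σ' t))]
  refine (integral_congr_ae ?_).trans (integral_zero _ _)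
  filter_upwards [hm.condExp_ne σ σ' t hσ] with ω hω
  simp [hω]

/-- Conditioning produces `p_σ g`, and the factor `μ_τ(t-1)` absorbs `g` because `σ` may follow `τ`.
Without such a preceding letter the indicator would remain. -/
lemma SwitchFiltration.integral_letter_same (hm : SwitchFiltration P μ 𝓔 p m) {f h : Ω → ℝ}
    {t : ℤ} (hf : AdaptedL2 P (m t) f) (hh : AdaptedL2 P (m (t - 1)) h) {τ σ : Fin d}
    (hτσ : (τ, σ) ∈ 𝓔) :
    ∫ ω, (f ω * μ t ω σ) * (h ω * μ (t - 1) ω τ * μ t ω σ) ∂P =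
      p σ * ∫ ω, f ω * (h ω * μ (t - 1) ω τ) ∂P := by
  have hq := hm.adapted_mul_letter hh τ
  set q : Ω → ℝ := fun ω => h ω * μ (t - 1) ω τ with hqdef
  obtain ⟨g, hg, hg01, hgc, hgτ⟩ := hm.condExp_sq σ t
  have hi := (hm.memLp_mul_letter hf σ).integrable_mul (hm.memLp_mul_letter hq σ)
  have e : ∀ ω, (f ω * μ t ω σ) * (q ω * μ t ω σ) = (f * q) ω * (μ t ω σ * μ t ω σ) := by
    intro ω; simp; ring
  have hi' : Integrable ((f * q) * fun ω => μ t ω σ * μ t ω σ) P :=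
    hi.congr (Filter.Eventually.of_forall e)
  change ∫ ω, (f ω * μ t ω σ) * (q ω * μ t ω σ) ∂P = _
  simp_rw [e]
  rw [← integral_mul_condExp (hm.le t) (hf.meas.mul hq.meas) hi'
    ((hm.memLp_letter σ t).integrable_mul (hm.memLp_letter σ t)), ← integral_const_mul]
  refine integral_congr_ae ?_
  filter_upwards [hgc, hgτ τ hτσ] with ω h1 h2
  rw [h1]
  simp only [Pi.mul_apply, hqdef]
  linear_combination p σ * f ω * h ω * h2

/-! ### Closed spans in `L²` and orthogonal projections. -/

/-- `f` is square integrable and belongs to the closed subspace generated by `G`. -/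
def InClosedSpan (P : Measure Ω) (G : Set (Ω → ℝ)) (f : Ω → ℝ) : Prop :=
  ∃ h : MemLp f 2 P, h.toLp f ∈ closedSpan P G

lemma InClosedSpan.memLp {G : Set (Ω → ℝ)} {f : Ω → ℝ} (h : InClosedSpan P G f) :
    MemLp f 2 P := h.1

lemma InClosedSpan.of_mem {G : Set (Ω → ℝ)} {f : Ω → ℝ} (hf : f ∈ G) (h : MemLp f 2 P) :
    InClosedSpan P G f :=
  ⟨h, Submodule.le_topologicalClosure _ (Submodule.subset_span ⟨f, hf, h.coeFn_toLp⟩)⟩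

lemma InClosedSpan.congr {G : Set (Ω → ℝ)} {f g : Ω → ℝ} (h : InClosedSpan P G f)
    (hfg : f =ᵐ[P] g) : InClosedSpan P G g := by
  obtain ⟨h1, h2⟩ := h
  refine ⟨(memLp_congr_ae hfg).1 h1, ?_⟩
  rwa [← (MemLp.toLp_eq_toLp_iff h1 _).2 hfg]

lemma InClosedSpan.mono {G G' : Set (Ω → ℝ)} (hG : G ⊆ G') {f : Ω → ℝ}
    (h : InClosedSpan P G f) : InClosedSpan P G' f :=
  ⟨h.1, Submodule.topologicalClosure_mono (Submodule.span_mono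
    (by rintro _ ⟨g, hg, h⟩; exact ⟨g, hG hg, h⟩)) h.2⟩

lemma InClosedSpan.add {G : Set (Ω → ℝ)} {f g : Ω → ℝ} (hf : InClosedSpan P G f)
    (hg : InClosedSpan P G g) : InClosedSpan P G (fun ω => f ω + g ω) :=
  ⟨hf.1.add hg.1, by
    have := Submodule.add_mem _ hf.2 hg.2
    rwa [← MemLp.toLp_add] at this⟩

lemma InClosedSpan.const_mul {G : Set (Ω → ℝ)} {f : Ω → ℝ} (hf : InClosedSpan P G f) (c : ℝ) :
    InClosedSpan P G (fun ω => c * f ω) :=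
  ⟨hf.1.const_mul c, by
    have := Submodule.smul_mem _ c hf.2
    rwa [← MemLp.toLp_const_smul] at this⟩

lemma InClosedSpan.zero (G : Set (Ω → ℝ)) : InClosedSpan P G (fun _ => 0) :=
  ⟨MemLp.zero', by
    have : (MemLp.zero' : MemLp (fun _ : Ω => (0 : ℝ)) 2 P).toLp _ = 0 := MemLp.toLp_zero _
    rw [this]; exact Submodule.zero_mem _⟩

lemma InClosedSpan.sum {κ : Type*} {G : Set (Ω → ℝ)} (s : Finset κ) {f : κ → Ω → ℝ}
    (hf : ∀ k ∈ s, InClosedSpan P G (f k)) : InClosedSpan P G (fun ω => ∑ k ∈ s, f k ω) := by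
  classical
  induction s using Finset.induction_on with
  | empty => simpa using InClosedSpan.zero G
  | insert a s ha ih =>
    simp_rw [Finset.sum_insert ha]
    exact (hf a (by simp)).add (ih fun k hk => hf k (by simp [hk]))

lemma InClosedSpan.aestronglyMeasurable (hm : m₀ ≤ mΩ)
    {G : Set (Ω → ℝ)} (hG : ∀ g ∈ G, AEStronglyMeasurable[m₀] g P) {f : Ω → ℝ}
    (hf : InClosedSpan P G f) : AEStronglyMeasurable[m₀] f P := by
  obtain ⟨h1, h2⟩ := hf
  have hle : closedSpan P G ≤ lpMeas ℝ ℝ m₀ 2 P := by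
    refine Submodule.topologicalClosure_minimal _ (Submodule.span_le.2 ?_) ?_
    · rintro f ⟨g, hg, hfg⟩
      exact mem_lpMeas_iff_aestronglyMeasurable.2 ((hG g hg).congr hfg.symm)
    · exact isClosed_aestronglyMeasurable hm
  exact (mem_lpMeas_iff_aestronglyMeasurable.1 (hle h2)).congr h1.coeFn_toLp

lemma integral_mul_eq_inner {f g : Ω → ℝ} (hf : MemLp f 2 P) (hg : MemLp g 2 P) :
    ∫ ω, f ω * g ω ∂P = inner ℝ (hf.toLp f) (hg.toLp g) := by
  rw [L2.inner_def]
  refine integral_congr_ae ?_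
  filter_upwards [hf.coeFn_toLp, hg.coeFn_toLp] with ω h1 h2
  simp [h1, h2, mul_comm]

lemma InClosedSpan.integral_mul_eq_zero {G : Set (Ω → ℝ)} {f h : Ω → ℝ}
    (hf : InClosedSpan P G f) (hh : MemLp h 2 P) (hG : ∀ g ∈ G, ∫ ω, g ω * h ω ∂P = 0) :
    ∫ ω, f ω * h ω ∂P = 0 := by
  obtain ⟨h1, h2⟩ := hf
  have hle : closedSpan P G ≤ (Submodule.span ℝ {hh.toLp h})ᗮ := by
    refine Submodule.topologicalClosure_minimal _ (Submodule.span_le.2 ?_)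
      (Submodule.isClosed_orthogonal _)
    rintro f ⟨g, hg, hfg⟩
    refine (Submodule.mem_orthogonal_singleton_iff_inner_left).2 ?_
    have := integral_mul_eq_inner (Lp.memLp f) hh
    rw [Lp.toLp_coeFn] at this
    rw [← this, ← hG g hg]
    refine integral_congr_ae ?_
    filter_upwards [hfg] with ω hω
    rw [hω]
  rw [integral_mul_eq_inner h1 hh]
  exact Submodule.mem_orthogonal_singleton_iff_inner_left.1 (hle h2)

/-- Since multiplication by `μ_σ(t)` is bounded on functions measurable at time `t`, checking
generators suffices: linearity gives the span, and the norm estimate gives its limits. -/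
lemma SwitchFiltration.inClosedSpan_mul_letter (hm : SwitchFiltration P μ 𝓔 p m) {t : ℤ}
    {σ : Fin d} {G G' : Set (Ω → ℝ)} (hG : ∀ g ∈ G, AEStronglyMeasurable[m t] g P)
    (hGG' : ∀ g ∈ G, InClosedSpan P G' (fun ω => g ω * μ t ω σ)) {f : Ω → ℝ}
    (hf : InClosedSpan P G f) : InClosedSpan P G' (fun ω => f ω * μ t ω σ) := by
  have hmeas := hf.aestronglyMeasurable (hm.le t) hG
  have hmem := hm.memLp_mul_letter ⟨hf.1, hmeas⟩ σ
  refine ⟨hmem, ?_⟩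
  obtain ⟨h1, h2⟩ := hf
  have hspan : ∀ q ∈ Submodule.span ℝ {f : Lp ℝ 2 P | ∃ g ∈ G, f =ᵐ[P] g},
      AEStronglyMeasurable[m t] q P ∧ InClosedSpan P G' (fun ω => q ω * μ t ω σ) := by
    intro q hq
    induction hq using Submodule.span_induction with
    | mem q hq =>
      obtain ⟨g, hg, hqg⟩ := hq
      refine ⟨(hG g hg).congr hqg.symm, (hGG' g hg).congr ?_⟩
      filter_upwards [hqg] with ω hω
      rw [hω]
    | zero =>
      refine ⟨aestronglyMeasurable_zero.congr (Lp.coeFn_zero ℝ 2 P).symm,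
        (InClosedSpan.zero G').congr ?_⟩
      filter_upwards [Lp.coeFn_zero ℝ 2 P] with ω hω
      rw [hω]
      simp
    | add a b _ _ ha hb =>
      refine ⟨(ha.1.add hb.1).congr (Lp.coeFn_add a b).symm, (ha.2.add hb.2).congr ?_⟩
      filter_upwards [Lp.coeFn_add a b] with ω hω
      rw [hω]
      simp [add_mul]
    | smul c a _ ha =>
      refine ⟨(ha.1.const_smul c).congr (Lp.coeFn_smul c a).symm, (ha.2.const_mul c).congr ?_⟩
      filter_upwards [Lp.coeFn_smul c a] with ω hω
      rw [hω]
      simp [mul_assoc]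
  obtain ⟨q, hq, hlim⟩ := mem_closure_iff_seq_limit.1 h2
  have hqs := fun n => hspan (q n) (hq n)
  refine (Submodule.isClosed_topologicalClosure _).mem_of_tendsto
    (b := Filter.atTop) (f := fun n => (hqs n).2.1.toLp _) ?_
    (Filter.Eventually.of_forall fun n => (hqs n).2.2)
  rw [Lp.tendsto_Lp_iff_tendsto_eLpNorm'']
  have hlim' := (Lp.tendsto_Lp_iff_tendsto_eLpNorm' _ _).1 hlim
  have hb : ∀ n, eLpNorm ((fun ω => q n ω * μ t ω σ) - fun ω => f ω * μ t ω σ) 2 P ^ 2 ≤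
      ENNReal.ofReal (p σ) * eLpNorm (⇑(q n) - ⇑(h1.toLp f)) 2 P ^ 2 := by
    intro n
    have e1 : eLpNorm (⇑(q n) - ⇑(h1.toLp f)) 2 P = eLpNorm (⇑(q n) - f) 2 P :=
      eLpNorm_congr_ae (by
        filter_upwards [h1.coeFn_toLp] with ω hω
        simp [hω])
    rw [e1]
    convert hm.eLpNorm_mul_letter_le ((hqs n).1.sub hmeas) σ using 3
    ext ω
    simp [sub_mul]
  have hz : Filter.Tendsto (fun n => ENNReal.ofReal (p σ) *
      eLpNorm (⇑(q n) - ⇑(h1.toLp f)) 2 P ^ 2) Filter.atTop (nhds 0) := by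
    have := ENNReal.Tendsto.const_mul (ENNReal.Tendsto.pow (n := 2) hlim')
      (Or.inr (ENNReal.ofReal_ne_top (r := p σ)))
    simpa using this
  have hsq := tendsto_of_tendsto_of_tendsto_of_le_of_le tendsto_const_nhds hz
    (fun _ => zero_le) hb
  -- The estimate controls squared norms, so a square root recovers convergence of the norms.
  have := (ENNReal.continuous_rpow_const (y := (1 / 2 : ℝ))).tendsto 0 |>.comp hsq
  have e0 : (0 : ENNReal) ^ (1 / 2 : ℝ) = 0 := ENNReal.zero_rpow_of_pos (by norm_num)
  rw [e0] at this
  refine this.congr fun n => ?_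
  simp only [Function.comp]
  rw [← ENNReal.rpow_natCast, ← ENNReal.rpow_mul]
  norm_num

lemma linProj_inClosedSpan (G : Set (Ω → ℝ)) (f : Ω → ℝ) :
    InClosedSpan P G (linProj P G f) := by
  have : CompleteSpace (closedSpan P G) :=
    (Submodule.isClosed_topologicalClosure _).completeSpace_coe
  unfold linProj
  split_ifs with h
  · refine ⟨Lp.memLp _, ?_⟩
    rw [Lp.toLp_coeFn]
    exact Submodule.starProjection_apply_mem _ _
  · exact InClosedSpan.zero G

/-- Characterization of the orthogonal projection. -/
lemma linProj_eq_of_orthogonal {G : Set (Ω → ℝ)} {f e : Ω → ℝ} (hf : MemLp f 2 P)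
    (he : InClosedSpan P G e)
    (horth : ∀ g ∈ G, ∫ ω, g ω * (f ω - e ω) ∂P = 0) : linProj P G f =ᵐ[P] e := by
  have : CompleteSpace (closedSpan P G) :=
    (Submodule.isClosed_topologicalClosure _).completeSpace_coe
  obtain ⟨h1, h2⟩ := he
  have key : (closedSpan P G).starProjection (hf.toLp f) = h1.toLp e := by
    refine Submodule.eq_starProjection_of_mem_orthogonal h2 ?_
    rw [Submodule.mem_orthogonal, ← MemLp.toLp_sub hf h1]
    intro q hq
    have h3 : InClosedSpan P G q := ⟨Lp.memLp q, by rwa [Lp.toLp_coeFn]⟩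
    have h4 := h3.integral_mul_eq_zero (hf.sub h1) horth
    rw [integral_mul_eq_inner (Lp.memLp q) (hf.sub h1), Lp.toLp_coeFn] at h4
    exact h4
  rw [linProj, dif_pos hf, key]
  exact h1.coeFn_toLp

lemma integral_mul_sub_linProj {G : Set (Ω → ℝ)} {f g : Ω → ℝ} (hf : MemLp f 2 P)
    (hg : InClosedSpan P G g) : ∫ ω, g ω * (f ω - linProj P G f ω) ∂P = 0 := by
  have : CompleteSpace (closedSpan P G) :=
    (Submodule.isClosed_topologicalClosure _).completeSpace_coe
  obtain ⟨h1, h2⟩ := hg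
  have hl := (linProj_inClosedSpan (P := P) G f).1
  rw [show (fun ω => g ω * (f ω - linProj P G f ω)) = fun ω => g ω * (f - linProj P G f) ω from
    rfl, integral_mul_eq_inner h1 (hf.sub hl), MemLp.toLp_sub hf hl]
  have : hl.toLp (linProj P G f) = (closedSpan P G).starProjection (hf.toLp f) := by
    rw [← Lp.toLp_coeFn ((closedSpan P G).starProjection (hf.toLp f)) (Lp.memLp _)]
    rw [MemLp.toLp_eq_toLp_iff, linProj, dif_pos hf]
  rw [this]
  exact (Submodule.mem_orthogonal _ _).1 (Submodule.sub_starProjection_mem_orthogonal _) _ h2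

end Adapted

/-! ### Bilinear calculus of cross-covariances. -/

section CrossCov

variable {Ω ι ι' κ : Type*} [mΩ : MeasurableSpace Ω] {P : Measure Ω}

/-- All components are square integrable. -/
def VecL2 (P : Measure Ω) (a : Ω → ι → ℝ) : Prop := ∀ i, MemLp (fun ω => a ω i) 2 P

lemma VecL2.smul {a : Ω → ι → ℝ} (ha : VecL2 P a) (c : ℝ) :
    VecL2 P (fun ω => c • a ω) := fun i => (ha i).const_mul c

lemma VecL2.mulVec [Fintype ι] {a : Ω → ι → ℝ} (ha : VecL2 P a) (M : Matrix ι' ι ℝ) :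
    VecL2 P (fun ω => M *ᵥ a ω) := fun i => by
  simp_rw [Matrix.mulVec, dotProduct]
  exact memLp_finsetSum _ fun k _ => (ha k).const_mul _

lemma crossCov_congr {a a' : Ω → ι → ℝ} {b b' : Ω → κ → ℝ} (ha : a =ᵐ[P] a')
    (hb : b =ᵐ[P] b') : crossCov P a b = crossCov P a' b' := by
  ext i j
  refine integral_congr_ae ?_
  filter_upwards [ha, hb] with ω h1 h2
  rw [h1, h2]

lemma crossCov_transpose (a : Ω → ι → ℝ) (b : Ω → κ → ℝ) :
    (crossCov P a b)ᵀ = crossCov P b a := by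
  ext i j
  simp [crossCov, mul_comm]

lemma crossCov_eq_zero_comm {a : Ω → ι → ℝ} {b : Ω → κ → ℝ} (h : crossCov P a b = 0) :
    crossCov P b a = 0 := by
  rw [← crossCov_transpose, h, Matrix.transpose_zero]

lemma crossCov_add_left {a a' : Ω → ι → ℝ} {b : Ω → κ → ℝ} (ha : VecL2 P a) (ha' : VecL2 P a')
    (hb : VecL2 P b) :
    crossCov P (fun ω => a ω + a' ω) b = crossCov P a b + crossCov P a' b := by
  ext i j
  simp only [crossCov, Matrix.of_apply, Pi.add_apply, add_mul, Matrix.add_apply]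
  exact integral_add ((ha i).integrable_mul (hb j)) ((ha' i).integrable_mul (hb j))

lemma crossCov_smul_left (a : Ω → ι → ℝ) (b : Ω → κ → ℝ) (c : ℝ) :
    crossCov P (fun ω => c • a ω) b = c • crossCov P a b := by
  ext i j
  simp only [crossCov, Matrix.of_apply, Pi.smul_apply, smul_eq_mul, Matrix.smul_apply, mul_assoc]
  exact integral_const_mul _ _

lemma crossCov_sub_left {a a' : Ω → ι → ℝ} {b : Ω → κ → ℝ} (ha : VecL2 P a) (ha' : VecL2 P a')
    (hb : VecL2 P b) :
    crossCov P (fun ω => a ω - a' ω) b = crossCov P a b - crossCov P a' b := by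
  ext i j
  simp only [crossCov, Matrix.of_apply, Pi.sub_apply, sub_mul, Matrix.sub_apply]
  exact integral_sub ((ha i).integrable_mul (hb j)) ((ha' i).integrable_mul (hb j))

lemma crossCov_sum_left {ν : Type*} {s : Finset ν} {a : ν → Ω → ι → ℝ} {b : Ω → κ → ℝ}
    (ha : ∀ k ∈ s, VecL2 P (a k)) (hb : VecL2 P b) :
    crossCov P (fun ω => ∑ k ∈ s, a k ω) b = ∑ k ∈ s, crossCov P (a k) b := by
  ext i j
  simp only [crossCov, Matrix.of_apply, Finset.sum_apply, Finset.sum_mul, Matrix.sum_apply]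
  exact integral_finsetSum s fun k hk => (ha k hk i).integrable_mul (hb j)

lemma crossCov_mulVec_left [Fintype ι] {a : Ω → ι → ℝ} {b : Ω → κ → ℝ} (M : Matrix ι' ι ℝ)
    (ha : VecL2 P a) (hb : VecL2 P b) :
    crossCov P (fun ω => M *ᵥ a ω) b = M * crossCov P a b := by
  ext i j
  simp only [crossCov, Matrix.of_apply, Matrix.mulVec, dotProduct, Finset.sum_mul,
    Matrix.mul_apply]
  rw [integral_finsetSum]
  · simp_rw [mul_assoc, integral_const_mul]
  · intro k _
    simp_rw [mul_assoc]
    exact ((ha k).integrable_mul (hb j)).const_mul _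

lemma crossCov_add_right {a : Ω → ι → ℝ} {b b' : Ω → κ → ℝ} (ha : VecL2 P a) (hb : VecL2 P b)
    (hb' : VecL2 P b') :
    crossCov P a (fun ω => b ω + b' ω) = crossCov P a b + crossCov P a b' := by
  rw [← crossCov_transpose, crossCov_add_left hb hb' ha, Matrix.transpose_add,
    crossCov_transpose, crossCov_transpose]

lemma crossCov_smul_right (a : Ω → ι → ℝ) (b : Ω → κ → ℝ) (c : ℝ) :
    crossCov P a (fun ω => c • b ω) = c • crossCov P a b := by
  rw [← crossCov_transpose, crossCov_smul_left, Matrix.transpose_smul, crossCov_transpose]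

lemma crossCov_sub_right {a : Ω → ι → ℝ} {b b' : Ω → κ → ℝ} (ha : VecL2 P a) (hb : VecL2 P b)
    (hb' : VecL2 P b') :
    crossCov P a (fun ω => b ω - b' ω) = crossCov P a b - crossCov P a b' := by
  rw [← crossCov_transpose, crossCov_sub_left hb hb' ha, Matrix.transpose_sub,
    crossCov_transpose, crossCov_transpose]

lemma crossCov_mulVec_right [Fintype κ] {a : Ω → ι → ℝ} {b : Ω → κ → ℝ} (M : Matrix ι' κ ℝ)
    (ha : VecL2 P a) (hb : VecL2 P b) :
    crossCov P a (fun ω => M *ᵥ b ω) = crossCov P a b * Mᵀ := by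
  rw [← crossCov_transpose, crossCov_mulVec_left M hb ha, Matrix.transpose_mul,
    crossCov_transpose]

end CrossCov

/-! ### Words built by gating with one letter at a time. -/

section Gate

variable {Ω ι κ : Type*} {d : ℕ} {μ : Proc Ω (Fin d)} {p : Fin d → ℝ}

/-- The vector `a` multiplied by `μ_σ(t)`. -/
def gate (μ : Proc Ω (Fin d)) (σ : Fin d) (t : ℤ) (a : Ω → ι → ℝ) : Ω → ι → ℝ :=
  fun ω i => a ω i * μ t ω σ

lemma switchWord_append_singleton (μ : Proc Ω (Fin d)) (w : List (Fin d)) (σ : Fin d) (t : ℤ)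
    (ω : Ω) : switchWord μ (w ++ [σ]) t ω = switchWord μ w (t - 1) ω * μ t ω σ := by
  induction w with
  | nil => simp [switchWord]
  | cons τ w ih =>
    rw [List.cons_append, switchWord, switchWord, ih, List.length_append, mul_assoc]
    have : t - ((w.length + [σ].length : ℕ) : ℤ) = t - 1 - w.length := by
      push_cast [List.length_singleton]
      ring
    rw [this]

lemma zProc_nil (μ : Proc Ω (Fin d)) (p : Fin d → ℝ) (r : Proc Ω ι) (t : ℤ) :
    zProc μ p r [] t = r t := by
  ext ω i
  simp [zProc, switchWord]

/-- The last letter of a word is the most recent one, so removing it moves back by one time unit.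
This is the reason for later inductions from the right end. -/
lemma zProc_append_singleton (hp : ∀ σ, 0 < p σ) (r : Proc Ω ι) (w : List (Fin d)) (σ : Fin d)
    (t : ℤ) : zProc μ p r (w ++ [σ]) t =
      fun ω => (1 / √(p σ)) • gate μ σ (t - 1) (zProc μ p r w (t - 1)) ω := by
  ext ω i
  have hw : 0 ≤ (w.map p).prod := by
    refine List.prod_nonneg fun a ha => ?_
    obtain ⟨τ, -, rfl⟩ := List.mem_map.1 ha
    exact (hp τ).le
  simp only [zProc, gate, switchWord_append_singleton, Pi.smul_apply, smul_eq_mul,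
    List.map_append, List.map_cons, List.map_nil, List.prod_append, List.prod_singleton,
    Real.sqrt_mul hw, List.length_append, List.length_singleton]
  have : t - ((w.length + 1 : ℕ) : ℤ) = t - 1 - w.length := by push_cast; ring
  rw [this]
  field_simp

lemma zProc_singleton (hp : ∀ σ, 0 < p σ) (r : Proc Ω ι) (σ : Fin d) (t : ℤ) :
    zProc μ p r [σ] t = fun ω => (1 / √(p σ)) • gate μ σ (t - 1) (r (t - 1)) ω := by
  have := zProc_append_singleton (μ := μ) hp r [] σ t
  rwa [List.nil_append, zProc_nil] at this

lemma gate_add (σ : Fin d) (t : ℤ) (a b : Ω → ι → ℝ) :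
    gate μ σ t (fun ω => a ω + b ω) = fun ω => gate μ σ t a ω + gate μ σ t b ω := by
  ext ω i
  simp [gate, add_mul]

lemma gate_sub (σ : Fin d) (t : ℤ) (a b : Ω → ι → ℝ) :
    gate μ σ t (fun ω => a ω - b ω) = fun ω => gate μ σ t a ω - gate μ σ t b ω := by
  ext ω i
  simp [gate, sub_mul]

lemma gate_mulVec [Fintype ι] (σ : Fin d) (t : ℤ) (M : Matrix κ ι ℝ) (a : Ω → ι → ℝ) :
    gate μ σ t (fun ω => M *ᵥ a ω) = fun ω => M *ᵥ gate μ σ t a ω := by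
  ext ω i
  simp [gate, Matrix.mulVec, dotProduct, Finset.sum_mul, mul_assoc]

lemma zProc_congr [MeasurableSpace Ω] {P : Measure Ω} {r r' : Proc Ω ι}
    (h : ∀ t, r t =ᵐ[P] r' t) (w : List (Fin d)) (t : ℤ) :
    zProc μ p r w t =ᵐ[P] zProc μ p r' w t := by
  filter_upwards [h (t - w.length)] with ω hω
  ext i
  simp [zProc, hω]

end Gate

/-! ### Covariances of gated vectors. -/

section VecAdapted

variable {Ω ι κ : Type*} {m₀ : MeasurableSpace Ω} [mΩ : MeasurableSpace Ω] {P : Measure Ω}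
  [IsProbabilityMeasure P]
  {d : ℕ} {μ : Proc Ω (Fin d)} {𝓔 : Set (Fin d × Fin d)} {p : Fin d → ℝ}
  {m : ℤ → MeasurableSpace Ω}

/-- All components are square integrable and `m`-measurable up to null sets. -/
def VecAdapted (P : Measure Ω) (m : MeasurableSpace Ω) (a : Ω → ι → ℝ) : Prop :=
  ∀ i, @AdaptedL2 Ω mΩ P m (fun ω => a ω i)

lemma VecAdapted.vecL2 {a : Ω → ι → ℝ} (ha : VecAdapted P m₀ a) :
    VecL2 P a := fun i => (ha i).memLp

lemma VecAdapted.add {a b : Ω → ι → ℝ} (ha : VecAdapted P m₀ a)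
    (hb : VecAdapted P m₀ b) : VecAdapted P m₀ (fun ω => a ω + b ω) := fun i =>
  ⟨(ha i).1.add (hb i).1, (ha i).2.add (hb i).2⟩

lemma VecAdapted.sub {a b : Ω → ι → ℝ} (ha : VecAdapted P m₀ a)
    (hb : VecAdapted P m₀ b) : VecAdapted P m₀ (fun ω => a ω - b ω) := fun i =>
  ⟨(ha i).1.sub (hb i).1, (ha i).2.sub (hb i).2⟩

lemma VecAdapted.smul {a : Ω → ι → ℝ} (ha : VecAdapted P m₀ a)
    (c : ℝ) : VecAdapted P m₀ (fun ω => c • a ω) := fun i =>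
  ⟨(ha i).1.const_mul c, (ha i).2.const_mul c⟩

lemma VecAdapted.mulVec [Fintype ι] {a : Ω → ι → ℝ}
    (ha : VecAdapted P m₀ a) (M : Matrix κ ι ℝ) : VecAdapted P m₀ (fun ω => M *ᵥ a ω) :=
  fun i => ⟨ha.vecL2.mulVec M i, by
    choose f hf haf using fun k => (ha k).2
    refine ⟨fun ω => ∑ k, M i k * f k ω,
      Finset.stronglyMeasurable_fun_sum _ fun k _ => (hf k).const_mul _, ?_⟩
    filter_upwards [ae_all_iff.2 haf] with ω hω
    simp only [Matrix.mulVec, dotProduct]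
    exact Finset.sum_congr rfl fun k _ => by rw [hω k]⟩

lemma eq_sum_gate {t : ℤ} {α : Fin d → ℝ} (hα : ∀ᵐ ω ∂P, ∑ σ, α σ * μ t ω σ = 1)
    (c : Ω → ι → ℝ) : c =ᵐ[P] fun ω => ∑ σ, α σ • gate μ σ t c ω := by
  filter_upwards [hα] with ω hω
  ext i
  simp only [gate, Finset.sum_apply, Pi.smul_apply, smul_eq_mul]
  conv_lhs => rw [← mul_one (c ω i), ← hω, Finset.mul_sum]
  exact Finset.sum_congr rfl fun σ _ => by ring

namespace SwitchFiltration

lemma vecL2_gate (hm : SwitchFiltration P μ 𝓔 p m) {t : ℤ} {a : Ω → ι → ℝ}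
    (ha : VecAdapted P (m t) a) (σ : Fin d) : VecL2 P (gate μ σ t a) :=
  fun i => hm.memLp_mul_letter (ha i) σ

lemma vecAdapted_gate (hm : SwitchFiltration P μ 𝓔 p m) {t : ℤ} {a : Ω → ι → ℝ}
    (ha : VecAdapted P (m (t - 1)) a) (σ : Fin d) : VecAdapted P (m t) (gate μ σ (t - 1) a) :=
  fun i => hm.adapted_mul_letter (ha i) σ

lemma vecAdapted_zProc (hm : SwitchFiltration P μ 𝓔 p m) {r : Proc Ω ι}
    (hr : ∀ t, VecAdapted P (m t) (r t)) (w : List (Fin d)) (t : ℤ) :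
    VecAdapted P (m t) (zProc μ p r w t) := by
  induction w using List.reverseRecOn generalizing t with
  | nil => rw [zProc_nil]; exact hr t
  | append_singleton w σ ih =>
    rw [zProc_append_singleton hm.p_pos]
    exact (hm.vecAdapted_gate (ih (t - 1)) σ).smul _

lemma crossCov_gate_ne (hm : SwitchFiltration P μ 𝓔 p m) {t : ℤ} {a : Ω → ι → ℝ}
    {b : Ω → κ → ℝ} (ha : VecAdapted P (m t) a) (hb : VecAdapted P (m t) b) {σ σ' : Fin d}
    (h : σ ≠ σ') : crossCov P (gate μ σ t a) (gate μ σ' t b) = 0 := by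
  ext i j
  exact hm.integral_letter_ne (ha i) (hb j) h

/-- Multiplication by `μ_σ(t)` scales the covariance with a past variable whose last letter may
be followed by `σ`. -/
lemma crossCov_gate_zProc (hm : SwitchFiltration P μ 𝓔 p m) {t : ℤ} {a : Ω → ι → ℝ}
    (ha : VecAdapted P (m t) a) {r : Proc Ω κ} (hr : ∀ t, VecAdapted P (m t) (r t))
    (w : List (Fin d)) {τ σ : Fin d} (h : (τ, σ) ∈ 𝓔) :
    crossCov P (gate μ σ t a) (gate μ σ t (zProc μ p r (w ++ [τ]) t)) =
      p σ • crossCov P a (zProc μ p r (w ++ [τ]) t) := by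
  have e1 : gate μ σ t (zProc μ p r (w ++ [τ]) t) = fun ω => (1 / √(p τ)) •
      gate μ σ t (gate μ τ (t - 1) (zProc μ p r w (t - 1))) ω := by
    rw [zProc_append_singleton hm.p_pos]
    ext ω i
    simp [gate, mul_assoc]
  rw [e1, zProc_append_singleton hm.p_pos, crossCov_smul_right, crossCov_smul_right, smul_comm]
  congr 1
  ext i j
  exact hm.integral_letter_same (ha i) (hm.vecAdapted_zProc hr w (t - 1) j) h

lemma gate_zProc_eq_zero (hm : SwitchFiltration P μ 𝓔 p m) {t : ℤ} (r : Proc Ω κ)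
    (w : List (Fin d)) {τ σ : Fin d} (h : (τ, σ) ∉ 𝓔) :
    gate μ σ t (zProc μ p r (w ++ [τ]) t) =ᵐ[P] 0 := by
  rw [zProc_append_singleton hm.p_pos]
  filter_upwards [hm.pair_eq_zero τ σ t h] with ω hω
  ext i
  simp only [gate, Pi.smul_apply, smul_eq_mul, Pi.zero_apply]
  linear_combination (1 / √(p τ)) * zProc μ p r w (t - 1) ω i * hω

/-- If the last letter of `w` may be followed by `σ`, gating only scales the covariance; otherwise
the gated word vanishes. The empty word has no last letter and is excluded. -/
lemma crossCov_gate_zProc_eq_zero (hm : SwitchFiltration P μ 𝓔 p m) {t : ℤ} {a : Ω → ι → ℝ}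
    (ha : VecAdapted P (m t) a) {r : Proc Ω κ} (hr : ∀ t, VecAdapted P (m t) (r t))
    {w : List (Fin d)} (hw : w ≠ []) (σ : Fin d) (h : crossCov P a (zProc μ p r w t) = 0) :
    crossCov P (gate μ σ t a) (gate μ σ t (zProc μ p r w t)) = 0 := by
  obtain ⟨w, τ, rfl⟩ := (List.eq_nil_or_concat' w).resolve_left hw
  by_cases hτ : (τ, σ) ∈ 𝓔
  · rw [hm.crossCov_gate_zProc ha hr w hτ, h, smul_zero]
  · rw [crossCov_congr (Filter.EventuallyEq.refl _ _) (hm.gate_zProc_eq_zero r w hτ)]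
    ext i j
    simp [crossCov]

/-- Both vectors are expanded by `∑ α_σ μ_σ(t) = 1`. Distinct letters are uncorrelated, and the
diagonal terms vanish by hypothesis. Orthogonality assumed for one-letter words thus passes to
current values. -/
lemma crossCov_eq_zero_of_gate (hm : SwitchFiltration P μ 𝓔 p m) {t : ℤ} {α : Fin d → ℝ}
    (hα : ∀ᵐ ω ∂P, ∑ σ, α σ * μ t ω σ = 1) {a : Ω → ι → ℝ}
    {b : Ω → κ → ℝ} (ha : VecAdapted P (m t) a) (hb : VecAdapted P (m t) b)
    (h : ∀ σ, crossCov P (gate μ σ t a) (gate μ σ t b) = 0) : crossCov P a b = 0 := by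
  rw [crossCov_congr (eq_sum_gate hα a) (Filter.EventuallyEq.refl _ b),
    crossCov_sum_left (fun σ _ => (hm.vecL2_gate ha σ).smul _) hb.vecL2]
  refine Finset.sum_eq_zero fun σ _ => ?_
  rw [crossCov_smul_left, crossCov_congr (Filter.EventuallyEq.refl _ _) (eq_sum_gate hα b)]
  refine smul_eq_zero_of_right _ (crossCov_eq_zero_comm ?_)
  rw [crossCov_sum_left (fun σ _ => (hm.vecL2_gate hb σ).smul _) (hm.vecL2_gate ha σ)]
  refine Finset.sum_eq_zero fun σ' _ => ?_
  rw [crossCov_smul_left]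
  by_cases hσ : σ' = σ
  · rw [hσ, crossCov_eq_zero_comm (h σ), smul_zero]
  · rw [hm.crossCov_gate_ne hb ha hσ, smul_zero]

end SwitchFiltration

end VecAdapted

/-! ### White noise and its past. -/

section Noise

variable {Ω ι κ : Type*} [mΩ : MeasurableSpace Ω] {P : Measure Ω} [IsProbabilityMeasure P]
  {d : ℕ} {μ : Proc Ω (Fin d)} {𝓔 : Set (Fin d × Fin d)} {p : Fin d → ℝ}
  {m : ℤ → MeasurableSpace Ω}

lemma crossCov_comp_right {κ' : Type*} {a : Ω → ι → ℝ} {b : Ω → κ → ℝ}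
    (h : crossCov P a b = 0) (e : κ' → κ) : crossCov P a (fun ω j => b ω (e j)) = 0 := by
  ext i j
  exact congrFun (congrFun h i) (e j)

lemma crossCov_comp_left {ι' : Type*} {a : Ω → ι → ℝ} {b : Ω → κ → ℝ}
    (h : crossCov P a b = 0) (e : ι' → ι) : crossCov P (fun ω i => a ω (e i)) b = 0 := by
  ext i j
  exact congrFun (congrFun h (e i)) j

lemma crossCov_zProc_append (hp : ∀ σ, 0 < p σ) (r : Proc Ω ι) (b : Ω → κ → ℝ)
    (w : List (Fin d)) (σ : Fin d) (t : ℤ) :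
    crossCov P b (zProc μ p r (w ++ [σ]) t) =
      (1 / √(p σ)) • crossCov P b (gate μ σ (t - 1) (zProc μ p r w (t - 1))) := by
  rw [zProc_append_singleton hp, crossCov_smul_right]

lemma crossCov_zProc_append_eq_zero_iff (hp : ∀ σ, 0 < p σ) (r : Proc Ω ι) (b : Ω → κ → ℝ)
    (w : List (Fin d)) (σ : Fin d) (t : ℤ) :
    crossCov P b (zProc μ p r (w ++ [σ]) t) = 0 ↔
      crossCov P b (gate μ σ (t - 1) (zProc μ p r w (t - 1))) = 0 := by
  have : 1 / √(p σ) ≠ 0 := by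
    have := Real.sqrt_pos.2 (hp σ)
    positivity
  rw [crossCov_zProc_append hp, smul_eq_zero_iff_right this]

lemma crossCov_zProc_singleton_eq_zero_iff (hp : ∀ σ, 0 < p σ) (r : Proc Ω ι) (b : Ω → κ → ℝ)
    (σ : Fin d) (t : ℤ) :
    crossCov P b (zProc μ p r [σ] t) = 0 ↔ crossCov P b (gate μ σ (t - 1) (r (t - 1))) = 0 := by
  have := crossCov_zProc_append_eq_zero_iff (P := P) (μ := μ) hp r b [] σ t
  rwa [List.nil_append, zProc_nil] at this

lemma crossCov_comm_eq_zero {a : Ω → ι → ℝ} {b : Ω → κ → ℝ} :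
    crossCov P a b = 0 ↔ crossCov P b a = 0 :=
  ⟨crossCov_eq_zero_comm, crossCov_eq_zero_comm⟩

lemma crossCov_gate_eq_zero_of_zProc (hp : ∀ σ, 0 < p σ) (r : Proc Ω ι) (r' : Proc Ω κ)
    {σ : Fin d} {t : ℤ} (h : crossCov P (zProc μ p r [σ] (t + 1)) (zProc μ p r' [σ] (t + 1)) = 0) :
    crossCov P (gate μ σ t (r t)) (gate μ σ t (r' t)) = 0 := by
  rw [crossCov_zProc_singleton_eq_zero_iff hp, crossCov_comm_eq_zero,
    crossCov_zProc_singleton_eq_zero_iff hp, crossCov_comm_eq_zero, add_sub_cancel_right] at h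
  exact h

lemma IsZMWSSI.vecAdapted {r : Proc Ω ι} (hr : IsZMWSSI P μ p r) (t : ℤ) :
    VecAdapted P (history μ r t) (r t) := by
  intro i
  constructor
  · have := hr.stationary.memLp ([], i) t
    simpa [zProc_nil] using this
  · have h : Measurable[history μ r t] (fun ω => r t ω i) :=
      (measurable_sigmaGen r (T := Set.Iic t) (k := t) (by simp) i).mono le_sup_left le_rfl
    exact h.stronglyMeasurable.aestronglyMeasurable

/-- The noise is uncorrelated with its past values weighted by the switching. -/
lemma IsWhiteNoise.crossCov_past_eq_zero [Fintype ι] [DecidableEq ι] {r : Proc Ω ι}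
    (hμ : IsAdmissible P μ 𝓔 p) (hm : SwitchFiltration P μ 𝓔 p m)
    (hr : IsWhiteNoise P μ 𝓔 p r) (had : ∀ t, VecAdapted P (m t) (r t))
    {w : List (Fin d)} (hw : w ≠ []) (t : ℤ) :
    crossCov P (r t) (zProc μ p r w t) = 0 := by
  obtain ⟨w, τ, rfl⟩ := (List.eq_nil_or_concat' w).resolve_left hw
  -- Whiteness only compares nonempty words. An allowed successor `σ` is appended on both sides, at
  -- time `t + 1`, and then stripped at the cost of the nonzero factor `p_σ`.
  obtain ⟨σ, hσ⟩ := hμ.exists_succ τ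
  have h := hr.uncorrelated (w ++ [τ] ++ [σ]) [] σ (t + 1) (by simp)
    (fun h => by simpa using congrArg List.length h)
  rw [crossCov_zProc_singleton_eq_zero_iff hm.p_pos, crossCov_comm_eq_zero,
    crossCov_zProc_append_eq_zero_iff hm.p_pos, add_sub_cancel_right,
    hm.crossCov_gate_zProc (had t) had w hσ] at h
  exact (smul_eq_zero_iff_right (hm.p_pos σ).ne').1 h

end Noise

/-! ### The input space and its filtration by word length. -/

section Input

variable {Ω ι κ : Type*} [mΩ : MeasurableSpace Ω] {P : Measure Ω} [IsProbabilityMeasure P]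
  {d nu : ℕ} {μ : Proc Ω (Fin d)} {𝓔 : Set (Fin d × Fin d)} {p : Fin d → ℝ}
  {m : ℤ → MeasurableSpace Ω} {u : Proc Ω (Fin nu)}

/-- The coordinates of `z^u_w(t)` for words `w` of length at least `k`. -/
def inputWords (μ : Proc Ω (Fin d)) (p : Fin d → ℝ) (u : Proc Ω (Fin nu)) (k : ℕ) (t : ℤ) :
    Set (Ω → ℝ) :=
  {g | ∃ (w : List (Fin d)) (i : Fin nu), k ≤ w.length ∧ g = fun ω => zProc μ p u w t ω i}

lemma inputWords_anti {k l : ℕ} (h : k ≤ l) (t : ℤ) :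
    inputWords μ p u l t ⊆ inputWords μ p u k t := by
  rintro g ⟨w, i, hw, rfl⟩
  exact ⟨w, i, h.trans hw, rfl⟩

lemma inputWords_subset_inputVars (k : ℕ) (t : ℤ) :
    inputWords μ p u k t ⊆ inputVars μ p u t := by
  rintro g ⟨w, i, -, rfl⟩
  exact ⟨w, i, rfl⟩

/-- Gating appends a letter up to the factor `√p_σ`, so the minimal word length grows by one. This
growth later separates gated projections from one-letter words. -/
lemma inClosedSpan_inputWords_gate (hm : SwitchFiltration P μ 𝓔 p m)
    (hu : ∀ t, VecAdapted P (m t) (u t)) {k : ℕ} {t : ℤ} {f : Ω → ℝ}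
    (hf : InClosedSpan P (inputWords μ p u k (t - 1)) f) (σ : Fin d) :
    InClosedSpan P (inputWords μ p u (k + 1) t) (fun ω => f ω * μ (t - 1) ω σ) := by
  refine hm.inClosedSpan_mul_letter ?_ ?_ hf
  · rintro g ⟨w, i, -, rfl⟩
    exact (hm.vecAdapted_zProc hu w (t - 1) i).meas
  · rintro g ⟨w, i, hw, rfl⟩
    have h1 : InClosedSpan P (inputWords μ p u (k + 1) t)
        (fun ω => zProc μ p u (w ++ [σ]) t ω i) :=
      InClosedSpan.of_mem ⟨w ++ [σ], i, by simpa using hw, rfl⟩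
        (hm.vecAdapted_zProc hu (w ++ [σ]) t i).memLp
    refine (h1.const_mul (√(p σ))).congr (Filter.Eventually.of_forall fun ω => ?_)
    have := Real.sqrt_pos.2 (hm.p_pos σ)
    simp only [zProc_append_singleton hm.p_pos, Pi.smul_apply, gate, smul_eq_mul]
    field_simp

lemma inClosedSpan_inputWords_zProc (hm : SwitchFiltration P μ 𝓔 p m)
    (hu : ∀ t, VecAdapted P (m t) (u t)) {k : ℕ} {r : Proc Ω ι}
    (hr : ∀ t i, InClosedSpan P (inputWords μ p u k t) (fun ω => r t ω i)) (w : List (Fin d))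
    (t : ℤ) (i : ι) : InClosedSpan P (inputWords μ p u k t) (fun ω => zProc μ p r w t ω i) := by
  induction w using List.reverseRecOn generalizing t with
  | nil => rw [zProc_nil]; exact hr t i
  | append_singleton w σ ih =>
    rw [zProc_append_singleton hm.p_pos]
    exact ((inClosedSpan_inputWords_gate hm hu (ih (t - 1)) σ).mono
      (inputWords_anti (Nat.le_succ k) t)).const_mul _

lemma InClosedSpan.crossCov_eq_zero {k : ℕ} {t : ℤ} {a : Ω → ι → ℝ} {b : Ω → κ → ℝ}
    (ha : ∀ i, InClosedSpan P (inputWords μ p u k t) (fun ω => a ω i)) (hb : VecL2 P b)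
    (h : ∀ w : List (Fin d), k ≤ w.length → crossCov P b (zProc μ p u w t) = 0) :
    crossCov P a b = 0 := by
  ext i j
  refine (ha i).integral_mul_eq_zero (hb j) ?_
  rintro g ⟨w, l, hw, rfl⟩
  exact congrFun (congrFun (crossCov_eq_zero_comm (h w hw)) l) j

/-- Componentwise projection of `r(t)` onto the space generated by the input. -/
def inputPart (P : Measure Ω) (μ : Proc Ω (Fin d)) (p : Fin d → ℝ) (u : Proc Ω (Fin nu))
    (r : Proc Ω ι) : Proc Ω ι :=
  fun t ω i => linProj P (inputVars μ p u t) (fun ω' => r t ω' i) ω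

/-- The part of `r(t)` that is orthogonal to the input. -/
def residual (P : Measure Ω) (μ : Proc Ω (Fin d)) (p : Fin d → ℝ) (u : Proc Ω (Fin nu))
    (r : Proc Ω ι) : Proc Ω ι :=
  fun t ω => r t ω - inputPart P μ p u r t ω

lemma crossCov_residual_input {r : Proc Ω ι} {t : ℤ} (hr : VecL2 P (r t))
    (hu : ∀ w, VecL2 P (zProc μ p u w t)) (w : List (Fin d)) :
    crossCov P (residual P μ p u r t) (zProc μ p u w t) = 0 := by
  ext i j
  have := integral_mul_sub_linProj (G := inputVars μ p u t) (hr i)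
    (InClosedSpan.of_mem ⟨w, j, rfl⟩ (hu w j))
  refine Eq.trans (integral_congr_ae (Filter.Eventually.of_forall fun ω => ?_)) this
  exact mul_comm _ _

/-- A vector whose difference from `e`, a vector in the input space, is orthogonal to the input
has input part `e`. -/
lemma inputPart_eq_of_orthogonal {r : Proc Ω ι} [Countable ι] {t : ℤ} (hr : VecL2 P (r t))
    {e : Ω → ι → ℝ} (he : ∀ i, InClosedSpan P (inputVars μ p u t) (fun ω => e ω i))
    {f : Ω → ι → ℝ} (hf : f =ᵐ[P] fun ω => r t ω - e ω)
    (horth : ∀ w, crossCov P f (zProc μ p u w t) = 0) :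
    inputPart P μ p u r t =ᵐ[P] e := by
  have : ∀ i, ∀ᵐ ω ∂P, inputPart P μ p u r t ω i = e ω i := fun i => by
    refine linProj_eq_of_orthogonal (hr i) (he i) ?_
    rintro g ⟨w, j, rfl⟩
    have h1 := congrFun (congrFun (horth w) i) j
    refine Eq.trans (integral_congr_ae ?_) h1
    filter_upwards [hf] with ω hω
    simp only [hω, Pi.sub_apply]
    ring
  filter_upwards [ae_all_iff.2 this] with ω hω
  ext i
  exact hω i

end Input

/-! ### The residual state and output follow the stochastic part. -/

namespace IsSGLSS

variable {Ω : Type*} [mΩ : MeasurableSpace Ω] {P : Measure Ω} [IsProbabilityMeasure P]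
  {d nx nn nu ny : ℕ} {μ : Proc Ω (Fin d)} {𝓔 : Set (Fin d × Fin d)} {p : Fin d → ℝ}
  {y : Proc Ω (Fin ny)} {u : Proc Ω (Fin nu)} {S : GLSS Ω d nx nn nu ny}

/-- The history of state, noise and input, together with the strict past of the switching. -/
abbrev past (μ : Proc Ω (Fin d)) (u : Proc Ω (Fin nu)) (S : GLSS Ω d nx nn nu ny) :
    ℤ → MeasurableSpace Ω :=
  history μ (stack S.x (stack S.v u))

lemma filtration (hS : IsSGLSS P μ 𝓔 p y u S) (hμ : IsAdmissible P μ 𝓔 p) :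
    SwitchFiltration P μ 𝓔 p (past μ u S) :=
  switchFiltration_history hμ hS.zmwssi

lemma adapted_state (hS : IsSGLSS P μ 𝓔 p y u S) (t : ℤ) :
    VecAdapted P (past μ u S t) (S.x t) := fun i => hS.zmwssi.vecAdapted t (Sum.inl i)

lemma adapted_stack (hS : IsSGLSS P μ 𝓔 p y u S) (t : ℤ) :
    VecAdapted P (past μ u S t) (stack S.v u t) := fun i => hS.zmwssi.vecAdapted t (Sum.inr i)

lemma adapted_noise (hS : IsSGLSS P μ 𝓔 p y u S) (t : ℤ) :
    VecAdapted P (past μ u S t) (S.v t) := fun i => hS.adapted_stack t (Sum.inl i)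

lemma adapted_input (hS : IsSGLSS P μ 𝓔 p y u S) (t : ℤ) :
    VecAdapted P (past μ u S t) (u t) := fun i => hS.adapted_stack t (Sum.inr i)

lemma stack_past_stack (hS : IsSGLSS P μ 𝓔 p y u S) (hμ : IsAdmissible P μ 𝓔 p)
    {w : List (Fin d)} (hw : w ≠ []) (t : ℤ) :
    crossCov P (stack S.v u t) (zProc μ p (stack S.v u) w t) = 0 :=
  hS.whiteNoise.crossCov_past_eq_zero hμ (hS.filtration hμ) hS.adapted_stack hw t

lemma stack_past_input (hS : IsSGLSS P μ 𝓔 p y u S) (hμ : IsAdmissible P μ 𝓔 p)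
    {w : List (Fin d)} (hw : w ≠ []) (t : ℤ) :
    crossCov P (stack S.v u t) (zProc μ p u w t) = 0 :=
  crossCov_comp_right (hS.stack_past_stack hμ hw t) Sum.inr

lemma noise_past_noise (hS : IsSGLSS P μ 𝓔 p y u S) (hμ : IsAdmissible P μ 𝓔 p)
    {w : List (Fin d)} (hw : w ≠ []) (t : ℤ) :
    crossCov P (S.v t) (zProc μ p S.v w t) = 0 :=
  crossCov_comp_left (crossCov_comp_right (hS.stack_past_stack hμ hw t) Sum.inl) Sum.inl

lemma gate_noise_gate_input (hS : IsSGLSS P μ 𝓔 p y u S) (hμ : IsAdmissible P μ 𝓔 p)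
    (σ : Fin d) (t : ℤ) : crossCov P (gate μ σ t (S.v t)) (gate μ σ t (u t)) = 0 :=
  crossCov_gate_eq_zero_of_zProc hμ.p_pos _ _ (hS.noise_input σ (t + 1))

lemma gate_state_gate_stack (hS : IsSGLSS P μ 𝓔 p y u S) (hμ : IsAdmissible P μ 𝓔 p)
    (σ : Fin d) (t : ℤ) :
    crossCov P (gate μ σ t (S.x t)) (gate μ σ t (stack S.v u t)) = 0 :=
  crossCov_gate_eq_zero_of_zProc hμ.p_pos _ _ (hS.state_noise σ (t + 1))

lemma state_input (hS : IsSGLSS P μ 𝓔 p y u S) (hμ : IsAdmissible P μ 𝓔 p) (t : ℤ) :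
    crossCov P (S.x t) (u t) = 0 := by
  obtain ⟨α, hα⟩ := hμ.exists_alpha
  exact (hS.filtration hμ).crossCov_eq_zero_of_gate (hα t) (hS.adapted_state t)
    (hS.adapted_input t) fun σ => crossCov_comp_right (hS.gate_state_gate_stack hμ σ t) Sum.inr

lemma noise_input_words (hS : IsSGLSS P μ 𝓔 p y u S) (hμ : IsAdmissible P μ 𝓔 p)
    (w : List (Fin d)) (t : ℤ) : crossCov P (S.v t) (zProc μ p u w t) = 0 := by
  rcases eq_or_ne w [] with rfl | hw
  · obtain ⟨α, hα⟩ := hμ.exists_alpha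
    rw [zProc_nil]
    exact (hS.filtration hμ).crossCov_eq_zero_of_gate (hα t) (hS.adapted_noise t)
      (hS.adapted_input t) fun σ => hS.gate_noise_gate_input hμ σ t
  · exact crossCov_comp_left (hS.stack_past_input hμ hw t) Sum.inl

lemma vecL2_input_words (hS : IsSGLSS P μ 𝓔 p y u S) (hμ : IsAdmissible P μ 𝓔 p)
    (w : List (Fin d)) (t : ℤ) : VecL2 P (zProc μ p u w t) :=
  ((hS.filtration hμ).vecAdapted_zProc hS.adapted_input w t).vecL2

/-- The current input does not contribute to the projection of the state on the input space. -/
lemma inputPart_state_inClosedSpan (hS : IsSGLSS P μ 𝓔 p y u S) (hμ : IsAdmissible P μ 𝓔 p)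
    (t : ℤ) (i : Fin nx) :
    InClosedSpan P (inputWords μ p u 1 t) (fun ω => inputPart P μ p u S.x t ω i) := by
  set e : Ω → Fin nx → ℝ := fun ω i =>
    linProj P (inputWords μ p u 1 t) (fun ω' => S.x t ω' i) ω with he
  have hespan : ∀ i, InClosedSpan P (inputWords μ p u 1 t) (fun ω => e ω i) :=
    fun i => linProj_inClosedSpan _ _
  have hx := (hS.adapted_state t).vecL2
  have heL2 : VecL2 P e := fun i => (hespan i).memLp
  have heq : inputPart P μ p u S.x t =ᵐ[P] e := by
    refine inputPart_eq_of_orthogonal hx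
      (fun i => (hespan i).mono (inputWords_subset_inputVars 1 t)) Filter.EventuallyEq.rfl
      fun w => ?_
    -- For the empty word, both the state and the span of strictly past input words are orthogonal
    -- to `u(t)`; for the other words, orthogonality is the defining property of the projection.
    rcases eq_or_ne w [] with rfl | hw
    · rw [zProc_nil, crossCov_sub_left hx heL2 (hS.adapted_input t).vecL2, hS.state_input hμ,
        InClosedSpan.crossCov_eq_zero hespan (hS.adapted_input t).vecL2, sub_zero]
      intro w hw
      exact crossCov_comp_left (hS.stack_past_input hμ (List.ne_nil_of_length_pos hw) t) Sum.inr
    · ext i j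
      have := integral_mul_sub_linProj (G := inputWords μ p u 1 t) (hx i)
        (InClosedSpan.of_mem ⟨w, j, List.length_pos_of_ne_nil hw, rfl⟩
          (hS.vecL2_input_words hμ w t j))
      refine Eq.trans (integral_congr_ae (Filter.Eventually.of_forall fun ω => ?_)) this
      exact mul_comm _ _
  refine (hespan i).congr ?_
  filter_upwards [heq] with ω hω
  rw [hω]

lemma adapted_inputPart (hS : IsSGLSS P μ 𝓔 p y u S) (hμ : IsAdmissible P μ 𝓔 p) (t : ℤ) :
    VecAdapted P (past μ u S t) (inputPart P μ p u S.x t) := fun i =>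
  ⟨(hS.inputPart_state_inClosedSpan hμ t i).memLp,
    (hS.inputPart_state_inClosedSpan hμ t i).aestronglyMeasurable ((hS.filtration hμ).le t) (by
      rintro g ⟨w, j, -, rfl⟩
      exact ((hS.filtration hμ).vecAdapted_zProc hS.adapted_input w t j).meas)⟩

lemma adapted_residual (hS : IsSGLSS P μ 𝓔 p y u S) (hμ : IsAdmissible P μ 𝓔 p) (t : ℤ) :
    VecAdapted P (past μ u S t) (residual P μ p u S.x t) :=
  (hS.adapted_state t).sub (hS.adapted_inputPart hμ t)

lemma residual_input_words (hS : IsSGLSS P μ 𝓔 p y u S) (hμ : IsAdmissible P μ 𝓔 p)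
    (w : List (Fin d)) (t : ℤ) :
    crossCov P (residual P μ p u S.x t) (zProc μ p u w t) = 0 :=
  crossCov_residual_input (hS.adapted_state t).vecL2 (fun w => hS.vecL2_input_words hμ w t) w

/-- The gated state is orthogonal to the gated noise and input by assumption, so only its gated
projection on the input space needs an argument. -/
lemma gate_residual_gate_stack (hS : IsSGLSS P μ 𝓔 p y u S) (hμ : IsAdmissible P μ 𝓔 p)
    (σ : Fin d) (t : ℤ) :
    crossCov P (gate μ σ t (residual P μ p u S.x t)) (gate μ σ t (stack S.v u t)) = 0 := by
  have hm := hS.filtration hμ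
  have hb := hm.vecL2_gate (hS.adapted_stack t) σ
  unfold residual
  rw [gate_sub, crossCov_sub_left (hm.vecL2_gate (hS.adapted_state t) σ)
    (hm.vecL2_gate (hS.adapted_inputPart hμ t) σ) hb, hS.gate_state_gate_stack hμ, zero_sub,
    neg_eq_zero]
  -- The projection uses words of length at least one, and gating makes this at least two. Such
  -- words differ from every one-letter word, so whiteness applies.
  refine InClosedSpan.crossCov_eq_zero (μ := μ) (p := p) (u := u) (k := 2) (t := t + 1)
    (fun i => ?_) hb fun w hw => ?_
  · have := inClosedSpan_inputWords_gate (t := t + 1) (k := 1) (f := fun ω =>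
      inputPart P μ p u S.x t ω i) hm hS.adapted_input
      (by rw [add_sub_cancel_right]; exact hS.inputPart_state_inClosedSpan hμ t i) σ
    rwa [add_sub_cancel_right] at this
  · have h := hS.whiteNoise.uncorrelated w [] σ (t + 1) (by rintro rfl; simp at hw)
      (by rintro rfl; simp at hw)
    rw [crossCov_zProc_singleton_eq_zero_iff hμ.p_pos, add_sub_cancel_right] at h
    exact crossCov_eq_zero_comm (crossCov_comp_left h Sum.inr)

lemma stack_past_residual (hS : IsSGLSS P μ 𝓔 p y u S) (hμ : IsAdmissible P μ 𝓔 p)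
    {w : List (Fin d)} (hw : w ≠ []) (t : ℤ) :
    crossCov P (stack S.v u t) (zProc μ p (residual P μ p u S.x) w t) = 0 := by
  have hm := hS.filtration hμ
  have hb := (hS.adapted_stack t).vecL2
  have e : zProc μ p (residual P μ p u S.x) w t =
      fun ω => zProc μ p S.x w t ω - zProc μ p (inputPart P μ p u S.x) w t ω := by
    ext ω i
    simp only [zProc, residual, Pi.sub_apply]
    ring
  rw [e, crossCov_sub_right hb (hm.vecAdapted_zProc hS.adapted_state w t).vecL2
    (hm.vecAdapted_zProc (hS.adapted_inputPart hμ) w t).vecL2, hS.noise_past_state w t hw,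
    zero_sub, neg_eq_zero]
  refine crossCov_eq_zero_comm (InClosedSpan.crossCov_eq_zero (fun i =>
    inClosedSpan_inputWords_zProc hm hS.adapted_input (hS.inputPart_state_inClosedSpan hμ)
      w t i) hb fun w' hw' => ?_)
  exact hS.stack_past_input hμ (List.ne_nil_of_length_pos hw') t

lemma state_step (hS : IsSGLSS P μ 𝓔 p y u S) (t : ℤ) :
    S.x t =ᵐ[P] fun ω => ∑ k, gate μ k (t - 1) (fun ω => S.A k *ᵥ S.x (t - 1) ω +
      S.B k *ᵥ u (t - 1) ω + S.K k *ᵥ S.v (t - 1) ω) ω := by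
  filter_upwards [hS.state_eq (t - 1)] with ω hω
  rw [sub_add_cancel] at hω
  rw [hω]
  refine Finset.sum_congr rfl fun k _ => ?_
  ext i
  simp [gate, mul_comm]

/-- Splitting by the last letter of `w`: no letter leaves the current input, uncorrelated with the
past residual; a letter other than `k` is uncorrelated with `k`; the letter `k` reduces to
orthogonality one time unit earlier, with one-letter words handled by `gate_residual_gate_stack`. -/
lemma gate_residual_input_words (hS : IsSGLSS P μ 𝓔 p y u S) (hμ : IsAdmissible P μ 𝓔 p)
    (k : Fin d) (w : List (Fin d)) (t : ℤ) :
    crossCov P (gate μ k (t - 1) (residual P μ p u S.x (t - 1))) (zProc μ p u w t) = 0 := by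
  have hm := hS.filtration hμ
  have had := hS.adapted_residual hμ (t - 1)
  induction w using List.reverseRecOn with
  | nil =>
    rw [zProc_nil]
    have := hS.stack_past_residual hμ (w := [k]) (by simp) t
    rw [crossCov_zProc_singleton_eq_zero_iff hμ.p_pos] at this
    exact crossCov_eq_zero_comm (crossCov_comp_left this Sum.inr)
  | append_singleton w σ _ =>
    rw [crossCov_zProc_append_eq_zero_iff hμ.p_pos]
    have hw := hm.vecAdapted_zProc hS.adapted_input w (t - 1)
    rcases eq_or_ne k σ with rfl | hk
    · rcases eq_or_ne w [] with rfl | hne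
      · rw [zProc_nil]
        exact crossCov_comp_right (hS.gate_residual_gate_stack hμ k (t - 1)) Sum.inr
      · exact hm.crossCov_gate_zProc_eq_zero had hS.adapted_input hne k
          (hS.residual_input_words hμ w (t - 1))
    · exact hm.crossCov_gate_ne had hw hk

lemma gate_noise_input_words (hS : IsSGLSS P μ 𝓔 p y u S) (hμ : IsAdmissible P μ 𝓔 p)
    (k : Fin d) (w : List (Fin d)) (t : ℤ) :
    crossCov P (gate μ k (t - 1) (S.v (t - 1))) (zProc μ p u w t) = 0 := by
  have hm := hS.filtration hμ
  have had := hS.adapted_noise (t - 1)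
  induction w using List.reverseRecOn with
  | nil =>
    rw [zProc_nil]
    have := hS.stack_past_stack hμ (w := [k]) (by simp) t
    rw [crossCov_zProc_singleton_eq_zero_iff hμ.p_pos] at this
    exact crossCov_eq_zero_comm (crossCov_comp_left (crossCov_comp_right this Sum.inl) Sum.inr)
  | append_singleton w σ _ =>
    rw [crossCov_zProc_append_eq_zero_iff hμ.p_pos]
    have hw := hm.vecAdapted_zProc hS.adapted_input w (t - 1)
    rcases eq_or_ne k σ with rfl | hk
    · rcases eq_or_ne w [] with rfl | hne
      · rw [zProc_nil]
        exact hS.gate_noise_gate_input hμ k (t - 1)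
      · exact hm.crossCov_gate_zProc_eq_zero had hS.adapted_input hne k
          (hS.noise_input_words hμ w (t - 1))
    · exact hm.crossCov_gate_ne had hw hk

lemma inClosedSpan_mulVec {n l : ℕ} {G : Set (Ω → ℝ)} {a : Ω → Fin n → ℝ}
    (ha : ∀ i, InClosedSpan P G (fun ω => a ω i)) (M : Matrix (Fin l) (Fin n) ℝ) (i : Fin l) :
    InClosedSpan P G (fun ω => (M *ᵥ a ω) i) := by
  simp only [Matrix.mulVec, dotProduct]
  exact InClosedSpan.sum _ fun k _ => (ha k).const_mul _

lemma inClosedSpan_input (hS : IsSGLSS P μ 𝓔 p y u S) (k : Fin nu) (t : ℤ) :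
    InClosedSpan P (inputWords μ p u 0 t) (fun ω => u t ω k) :=
  InClosedSpan.of_mem ⟨[], k, Nat.zero_le _, by rw [zProc_nil]⟩ (hS.adapted_input t k).memLp

/-- The residual state obeys the recursion of the stochastic part. -/
lemma residual_step (hS : IsSGLSS P μ 𝓔 p y u S) (hμ : IsAdmissible P μ 𝓔 p) (t : ℤ) :
    residual P μ p u S.x t =ᵐ[P] fun ω => ∑ k, gate μ k (t - 1) (fun ω =>
      S.A k *ᵥ residual P μ p u S.x (t - 1) ω + S.K k *ᵥ S.v (t - 1) ω) ω := by
  have hm := hS.filtration hμ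
  set n : Fin d → Ω → Fin nx → ℝ := fun k ω =>
    S.A k *ᵥ residual P μ p u S.x (t - 1) ω + S.K k *ᵥ S.v (t - 1) ω with hn
  set q : Fin d → Ω → Fin nx → ℝ := fun k ω =>
    S.A k *ᵥ inputPart P μ p u S.x (t - 1) ω + S.B k *ᵥ u (t - 1) ω with hq
  have hsplit : S.x t =ᵐ[P] fun ω => (∑ k, gate μ k (t - 1) (q k) ω) +
      ∑ k, gate μ k (t - 1) (n k) ω := by
    filter_upwards [hS.state_step t] with ω hω
    rw [hω, ← Finset.sum_add_distrib]
    refine Finset.sum_congr rfl fun k _ => ?_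
    ext i
    simp only [gate, hq, hn, residual, Pi.add_apply, Matrix.mulVec_sub, Pi.sub_apply]
    ring
  -- The projection obeys its own recursion, driven by `u`: the terms `q` lie in the input space,
  -- and the terms `n` are orthogonal to it.
  have key : inputPart P μ p u S.x t =ᵐ[P] fun ω => ∑ k, gate μ k (t - 1) (q k) ω := by
    refine inputPart_eq_of_orthogonal (hS.adapted_state t).vecL2 (fun i => ?_)
      (f := fun ω => ∑ k, gate μ k (t - 1) (n k) ω) ?_ fun w => ?_
    · simp only [Finset.sum_apply]
      refine InClosedSpan.sum _ fun k _ => InClosedSpan.mono (inputWords_subset_inputVars 1 t)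
        (inClosedSpan_inputWords_gate (k := 0) (f := fun ω => q k ω i) hm hS.adapted_input ?_ k)
      refine (inClosedSpan_mulVec (fun j => ?_) (S.A k) i).add
        (inClosedSpan_mulVec (fun j => hS.inClosedSpan_input j (t - 1)) (S.B k) i)
      exact (hS.inputPart_state_inClosedSpan hμ (t - 1) j).mono (inputWords_anti zero_le_one _)
    · filter_upwards [hsplit] with ω hω
      rw [hω, add_sub_cancel_left]
    · have hw := hS.vecL2_input_words hμ w t
      have hr := hS.adapted_residual hμ (t - 1)
      have hv := hS.adapted_noise (t - 1)
      rw [crossCov_sum_left (fun k _ => hm.vecL2_gate ((hr.mulVec (S.A k)).add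
        (hv.mulVec (S.K k))) k) hw]
      refine Finset.sum_eq_zero fun k _ => ?_
      rw [gate_add, crossCov_add_left (hm.vecL2_gate (hr.mulVec (S.A k)) k)
        (hm.vecL2_gate (hv.mulVec (S.K k)) k) hw, gate_mulVec, gate_mulVec,
        crossCov_mulVec_left _ (hm.vecL2_gate hr k) hw,
        crossCov_mulVec_left _ (hm.vecL2_gate hv k) hw, hS.gate_residual_input_words hμ,
        hS.gate_noise_input_words hμ, Matrix.mul_zero, Matrix.mul_zero, add_zero]
  filter_upwards [key, hsplit] with ω h1 h2
  rw [residual, h1, h2, add_sub_cancel_left]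

/-- The residual output is the output of the stochastic part. -/
lemma residual_output (hS : IsSGLSS P μ 𝓔 p y u S) (hμ : IsAdmissible P μ 𝓔 p) (t : ℤ) :
    residual P μ p u y t =ᵐ[P] fun ω =>
      S.C *ᵥ residual P μ p u S.x t ω + S.F *ᵥ S.v t ω := by
  have hr := hS.adapted_residual hμ t
  have hv := hS.adapted_noise t
  have hsplit : y t =ᵐ[P] fun ω => (S.C *ᵥ inputPart P μ p u S.x t ω + S.D *ᵥ u t ω) +
      (S.C *ᵥ residual P μ p u S.x t ω + S.F *ᵥ S.v t ω) := by
    filter_upwards [hS.output_eq t] with ω hω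
    rw [hω, residual, Matrix.mulVec_sub]
    abel
  have hyL2 : VecL2 P (y t) := by
    have h := ((((hS.adapted_inputPart hμ t).mulVec S.C).add
      ((hS.adapted_input t).mulVec S.D)).add ((hr.mulVec S.C).add (hv.mulVec S.F))).vecL2
    intro i
    refine (memLp_congr_ae ?_).1 (h i)
    filter_upwards [hsplit] with ω hω
    rw [hω]
  have key : inputPart P μ p u y t =ᵐ[P] fun ω =>
      S.C *ᵥ inputPart P μ p u S.x t ω + S.D *ᵥ u t ω := by
    refine inputPart_eq_of_orthogonal hyL2 (fun i => ?_)
      (f := fun ω => S.C *ᵥ residual P μ p u S.x t ω + S.F *ᵥ S.v t ω) ?_ fun w => ?_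
    · refine InClosedSpan.mono (inputWords_subset_inputVars 0 t) <|
        (inClosedSpan_mulVec (fun j => ?_) S.C i).add
        (inClosedSpan_mulVec (fun j => hS.inClosedSpan_input j t) S.D i)
      exact (hS.inputPart_state_inClosedSpan hμ t j).mono (inputWords_anti zero_le_one _)
    · filter_upwards [hsplit] with ω hω
      rw [hω, add_sub_cancel_left]
    · have hw := hS.vecL2_input_words hμ w t
      rw [crossCov_add_left (hr.mulVec S.C).vecL2 (hv.mulVec S.F).vecL2 hw,
        crossCov_mulVec_left _ hr.vecL2 hw, crossCov_mulVec_left _ hv.vecL2 hw,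
        hS.residual_input_words hμ, hS.noise_input_words hμ, Matrix.mul_zero, Matrix.mul_zero,
        add_zero]
  filter_upwards [key, hsplit] with ω h1 h2
  rw [residual, h1, h2, add_sub_cancel_left]

end IsSGLSS

/-! ### Matrix products along words. -/

section Words

variable {d n : ℕ}

lemma matWord_append (A : Fin d → Matrix (Fin n) (Fin n) ℝ) (w v : List (Fin d)) :
    matWord A (w ++ v) = matWord A v * matWord A w := by
  induction w with
  | nil => simp [matWord]
  | cons σ w ih => rw [List.cons_append, matWord, matWord, ih, Matrix.mul_assoc]

lemma matWord_append_singleton (A : Fin d → Matrix (Fin n) (Fin n) ℝ) (w : List (Fin d))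
    (σ : Fin d) : matWord A (w ++ [σ]) = A σ * matWord A w := by
  rw [matWord_append]
  simp [matWord]

lemma isChain_append_two {𝓔 : Set (Fin d × Fin d)} {w : List (Fin d)} {ρ τ : Fin d} :
    ((w ++ [ρ]) ++ [τ]).IsChain (fun a b => (a, b) ∈ 𝓔) ↔
      (w ++ [ρ]).IsChain (fun a b => (a, b) ∈ 𝓔) ∧ (ρ, τ) ∈ 𝓔 := by
  rw [List.isChain_append]
  simp

end Words

/-! ### Output covariances as Markov parameters. -/

namespace IsSGLSS

variable {Ω : Type*} [mΩ : MeasurableSpace Ω] {P : Measure Ω} [IsProbabilityMeasure P]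
  {d nx nn nu ny : ℕ} {μ : Proc Ω (Fin d)} {𝓔 : Set (Fin d × Fin d)} {p : Fin d → ℝ}
  {y : Proc Ω (Fin ny)} {u : Proc Ω (Fin nu)} {S : GLSS Ω d nx nn nu ny}

/-- The output of the stochastic part. -/
def stochasticOutput (P : Measure Ω) (μ : Proc Ω (Fin d)) (p : Fin d → ℝ) (u : Proc Ω (Fin nu))
    (S : GLSS Ω d nx nn nu ny) : Proc Ω (Fin ny) :=
  fun t ω => S.C *ᵥ residual P μ p u S.x t ω + S.F *ᵥ S.v t ω

lemma adapted_stochasticOutput (hS : IsSGLSS P μ 𝓔 p y u S) (hμ : IsAdmissible P μ 𝓔 p)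
    (t : ℤ) : VecAdapted P (past μ u S t) (stochasticOutput P μ p u S t) :=
  ((hS.adapted_residual hμ t).mulVec S.C).add ((hS.adapted_noise t).mulVec S.F)

lemma noise_past_output (hS : IsSGLSS P μ 𝓔 p y u S) (hμ : IsAdmissible P μ 𝓔 p)
    {w : List (Fin d)} (hw : w ≠ []) (t : ℤ) :
    crossCov P (S.v t) (zProc μ p (stochasticOutput P μ p u S) w t) = 0 := by
  have hm := hS.filtration hμ
  have e : zProc μ p (stochasticOutput P μ p u S) w t = fun ω =>
      S.C *ᵥ zProc μ p (residual P μ p u S.x) w t ω + S.F *ᵥ zProc μ p S.v w t ω := by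
    ext ω i
    simp only [zProc, stochasticOutput, Pi.add_apply, Matrix.mulVec, dotProduct, add_mul,
      Finset.sum_mul, mul_assoc]
  have hr := (hm.vecAdapted_zProc (hS.adapted_residual hμ) w t)
  have hv := (hm.vecAdapted_zProc hS.adapted_noise w t)
  have hv0 := (hS.adapted_noise t).vecL2
  rw [e, crossCov_add_right hv0 (hr.mulVec _).vecL2 (hv.mulVec _).vecL2,
    crossCov_mulVec_right _ hv0 hr.vecL2, crossCov_mulVec_right _ hv0 hv.vecL2,
    hS.noise_past_noise hμ hw t,
    show crossCov P (S.v t) (zProc μ p (residual P μ p u S.x) w t) = 0 from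
      crossCov_comp_left (hS.stack_past_residual hμ hw t) Sum.inl]
  simp

/-- In the recursion for the residual state, every letter other than `σ` is uncorrelated with a
vector gated by `σ`. -/
lemma crossCov_residual_gate (hS : IsSGLSS P μ 𝓔 p y u S) (hμ : IsAdmissible P μ 𝓔 p)
    {κ : Type*} (t : ℤ) (σ : Fin d) {b : Ω → κ → ℝ} (hb : VecAdapted P (past μ u S (t - 1)) b) :
    crossCov P (residual P μ p u S.x t) (gate μ σ (t - 1) b) =
      S.A σ * crossCov P (gate μ σ (t - 1) (residual P μ p u S.x (t - 1))) (gate μ σ (t - 1) b) +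
      S.K σ * crossCov P (gate μ σ (t - 1) (S.v (t - 1))) (gate μ σ (t - 1) b) := by
  have hm := hS.filtration hμ
  have hr := hS.adapted_residual hμ (t - 1)
  have hv := hS.adapted_noise (t - 1)
  have hgb := hm.vecL2_gate hb σ
  have hn := fun k => (hr.mulVec (S.A k)).add (hv.mulVec (S.K k))
  rw [crossCov_congr (hS.residual_step hμ t) Filter.EventuallyEq.rfl,
    crossCov_sum_left (fun k _ => hm.vecL2_gate (hn k) k) hgb,
    Finset.sum_eq_single σ (fun k _ hk => hm.crossCov_gate_ne (hn k) hb hk) (by simp),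
    gate_add, crossCov_add_left (hm.vecL2_gate (hr.mulVec (S.A σ)) σ)
      (hm.vecL2_gate (hv.mulVec (S.K σ)) σ) hgb, gate_mulVec, gate_mulVec,
    crossCov_mulVec_left _ (hm.vecL2_gate hr σ) hgb,
    crossCov_mulVec_left _ (hm.vecL2_gate hv σ) hgb]

/-- The noise is orthogonal to the past output, so only the `A_σ` term survives; the factor `p_σ /
√p_σ` leaves `√p_σ`. -/
lemma crossCov_residual_past_step (hS : IsSGLSS P μ 𝓔 p y u S) (hμ : IsAdmissible P μ 𝓔 p)
    (t : ℤ) (w : List (Fin d)) {τ σ : Fin d} (h : (τ, σ) ∈ 𝓔) :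
    crossCov P (residual P μ p u S.x t)
        (zProc μ p (stochasticOutput P μ p u S) ((w ++ [τ]) ++ [σ]) t) =
      √(p σ) • (S.A σ * crossCov P (residual P μ p u S.x (t - 1))
        (zProc μ p (stochasticOutput P μ p u S) (w ++ [τ]) (t - 1))) := by
  have hm := hS.filtration hμ
  have hq := hS.adapted_stochasticOutput hμ
  rw [crossCov_zProc_append hμ.p_pos,
    hS.crossCov_residual_gate hμ t σ (hm.vecAdapted_zProc hq _ _),
    hm.crossCov_gate_zProc (hS.adapted_residual hμ (t - 1)) hq w h,
    hm.crossCov_gate_zProc (hS.adapted_noise (t - 1)) hq w h,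
    hS.noise_past_output hμ (by simp) (t - 1), smul_zero, Matrix.mul_zero, add_zero,
    Matrix.mul_smul, smul_smul]
  congr 1
  rw [one_div, inv_mul_eq_div, Real.div_sqrt]

lemma crossCov_zProc_singleton_self {ι : Type*} (hp : ∀ σ, 0 < p σ) (r : Proc Ω ι) (σ : Fin d)
    (t : ℤ) : crossCov P (gate μ σ (t - 1) (r (t - 1))) (gate μ σ (t - 1) (r (t - 1))) =
      p σ • crossCov P (zProc μ p r [σ] t) (zProc μ p r [σ] t) := by
  rw [zProc_singleton hp, crossCov_smul_left, crossCov_smul_right, smul_smul, smul_smul]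
  have h1 := Real.sqrt_pos.2 (hp σ)
  have h2 := Real.mul_self_sqrt (hp σ).le
  have : p σ * (1 / √(p σ)) * (1 / √(p σ)) = 1 := by
    field_simp
    rw [pow_two, h2]
  rw [this, one_smul]

/-- Expanding the output, the mixed terms vanish because gated residual state and gated noise are
uncorrelated. The two remaining covariances are `p_σ P_σ` and `p_σ Q_σ`. -/
lemma crossCov_residual_past_letter (hS : IsSGLSS P μ 𝓔 p y u S) (hμ : IsAdmissible P μ 𝓔 p)
    (σ : Fin d) :
    crossCov P (residual P μ p u S.x 0) (zProc μ p (stochasticOutput P μ p u S) [σ] 0) =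
      (S.stochasticPart P μ p u).G P μ p σ := by
  have hm := hS.filtration hμ
  have hr := hS.adapted_residual hμ (0 - 1)
  have hv := hS.adapted_noise (0 - 1)
  have hgr := hm.vecL2_gate hr σ
  have hgv := hm.vecL2_gate hv σ
  have hrv : crossCov P (gate μ σ (0 - 1) (residual P μ p u S.x (0 - 1)))
      (gate μ σ (0 - 1) (S.v (0 - 1))) = 0 :=
    crossCov_comp_right (hS.gate_residual_gate_stack hμ σ (0 - 1)) Sum.inl
  have e : gate μ σ (0 - 1) (stochasticOutput P μ p u S (0 - 1)) = fun ω =>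
      S.C *ᵥ gate μ σ (0 - 1) (residual P μ p u S.x (0 - 1)) ω +
        S.F *ᵥ gate μ σ (0 - 1) (S.v (0 - 1)) ω := by
    unfold stochasticOutput
    rw [gate_add, gate_mulVec, gate_mulVec]
  rw [zProc_singleton hμ.p_pos, crossCov_smul_right,
    hS.crossCov_residual_gate hμ 0 σ (hS.adapted_stochasticOutput hμ (0 - 1)), e,
    crossCov_add_right hgr (hgr.mulVec _) (hgv.mulVec _),
    crossCov_add_right hgv (hgr.mulVec _) (hgv.mulVec _),
    crossCov_mulVec_right _ hgr hgr, crossCov_mulVec_right _ hgr hgv,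
    crossCov_mulVec_right _ hgv hgr, crossCov_mulVec_right _ hgv hgv, hrv,
    crossCov_eq_zero_comm hrv, crossCov_zProc_singleton_self hμ.p_pos,
    crossCov_zProc_singleton_self hμ.p_pos, Matrix.zero_mul, Matrix.zero_mul, add_zero, zero_add,
    Matrix.smul_mul, Matrix.smul_mul, Matrix.mul_smul, Matrix.mul_smul, ← smul_add, smul_smul,
    one_div, inv_mul_eq_div, Real.div_sqrt, ← Matrix.mul_assoc, ← Matrix.mul_assoc]
  rfl

/-- Each letter of `v` peeled from the right contributes one matrix and one time unit. Starting at
time `|v|` makes the recursion end at time `0`, where `G` is defined, so stationarity of the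
residual is not needed. -/
lemma crossCov_residual_past (hS : IsSGLSS P μ 𝓔 p y u S) (hμ : IsAdmissible P μ 𝓔 p)
    (σ : Fin d) (v : List (Fin d)) (hv : (σ :: v).IsChain fun a b => (a, b) ∈ 𝓔) :
    crossCov P (residual P μ p u S.x v.length)
        (zProc μ p (stochasticOutput P μ p u S) (σ :: v) v.length) =
      (v.map fun τ => √(p τ)).prod •
        (matWord S.A v * (S.stochasticPart P μ p u).G P μ p σ) := by
  induction v using List.reverseRecOn with
  | nil => simpa [matWord] using hS.crossCov_residual_past_letter hμ σ
  | append_singleton v τ ih =>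
    obtain ⟨w, ρ, hw⟩ := (List.eq_nil_or_concat' (σ :: v)).resolve_left (by simp)
    rw [← List.cons_append, hw, isChain_append_two] at hv
    rw [← List.cons_append, hw, hS.crossCov_residual_past_step hμ _ w hv.2]
    have hlen : (((v ++ [τ]).length : ℕ) : ℤ) - 1 = v.length := by simp
    rw [hlen, ← hw, ih (by rw [hw]; exact hv.1), matWord_append_singleton, Matrix.mul_smul,
      smul_smul, List.map_append, List.prod_append, Matrix.mul_assoc]
    simp [mul_comm]

/-- Products along forbidden transitions vanish. -/
lemma matWord_mul_G_eq_zero (hS : IsSGLSS P μ 𝓔 p y u S) (σ : Fin d) (v : List (Fin d))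
    (hv : ¬ (σ :: v).IsChain fun a b => (a, b) ∈ 𝓔) :
    matWord S.A v * (S.stochasticPart P μ p u).G P μ p σ = 0 := by
  induction v using List.reverseRecOn with
  | nil => simp at hv
  | append_singleton v τ ih =>
    obtain ⟨w, ρ, hw⟩ := (List.eq_nil_or_concat' (σ :: v)).resolve_left (by simp)
    rw [← List.cons_append, hw, isChain_append_two, ← hw] at hv
    rw [matWord_append_singleton, Matrix.mul_assoc]
    by_cases hc : (σ :: v).IsChain fun a b => (a, b) ∈ 𝓔
    · have hρ : (ρ, τ) ∉ 𝓔 := fun h => hv ⟨hc, h⟩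
      obtain ⟨hA, hK⟩ := hS.compatible ρ τ hρ
      -- A forbidden transition directly after `σ` must kill both terms of `G_σ`, hence needs `A_τ
      -- A_σ = 0` and `A_τ K_σ = 0`. A later one meets two consecutive state matrices.
      rcases List.eq_nil_or_concat' v with rfl | ⟨v', ρ', rfl⟩
      · obtain rfl : σ = ρ := by
          have := congrArg List.getLast? hw
          simpa using this
        -- Compatibility only gives this product times the noise covariance, which is nonsingular by
        -- whiteness and can be cancelled.
        have hAK : S.A τ * Matrix.fromCols (S.K σ) (S.B σ) = 0 := by
          obtain ⟨Q, hQ⟩ := hS.whiteNoise.nonsingular σ 0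
          have h0 := hK 0
          rw [← hQ] at h0
          rw [← Matrix.mul_one (S.A τ * _), ← Q.mul_inv, ← Matrix.mul_assoc, h0, Matrix.zero_mul]
        have hAK' : S.A τ * S.K σ = 0 := by
          rw [Matrix.mul_fromCols] at hAK
          ext i j
          exact congrFun (congrFun hAK i) (Sum.inl j)
        simp only [matWord, Matrix.one_mul, GBS.G, GLSS.stochasticPart, Matrix.mul_smul,
          Matrix.mul_add, ← Matrix.mul_assoc, hA, hAK', Matrix.zero_mul, add_zero, smul_zero]
      · obtain rfl : ρ' = ρ := by
          have := congrArg List.getLast? hw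
          rw [← List.cons_append, List.getLast?_concat, List.getLast?_concat] at this
          exact Option.some.inj this
        rw [matWord_append_singleton, Matrix.mul_assoc, ← Matrix.mul_assoc (S.A τ), hA,
          Matrix.zero_mul]
    · rw [ih hc, Matrix.mul_zero]

/-- The covariances of the residual output are the Markov parameters of the stochastic part. -/
lemma crossCov_residual_output (hS : IsSGLSS P μ 𝓔 p y u S) (hμ : IsAdmissible P μ 𝓔 p)
    (σ : Fin d) (v : List (Fin d)) (hv : (σ :: v).IsChain fun a b => (a, b) ∈ 𝓔) :
    crossCov P (residual P μ p u y v.length) (zProc μ p (residual P μ p u y) (σ :: v) v.length) =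
      (v.map fun τ => √(p τ)).prod •
        (S.C * matWord S.A v * (S.stochasticPart P μ p u).G P μ p σ) := by
  have hr := hS.adapted_residual hμ v.length
  have hn := hS.adapted_noise v.length
  have hz := (hS.filtration hμ).vecAdapted_zProc (hS.adapted_stochasticOutput hμ) (σ :: v)
    v.length
  rw [crossCov_congr (hS.residual_output hμ _) (zProc_congr (hS.residual_output hμ) _ _)]
  change crossCov P _ (zProc μ p (stochasticOutput P μ p u S) (σ :: v) v.length) = _
  rw [crossCov_add_left (hr.mulVec _).vecL2 (hn.mulVec _).vecL2 hz.vecL2,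
    crossCov_mulVec_left _ hr.vecL2 hz.vecL2, crossCov_mulVec_left _ hn.vecL2 hz.vecL2,
    hS.noise_past_output hμ (by simp), hS.crossCov_residual_past hμ σ v hv, Matrix.mul_zero,
    add_zero, Matrix.mul_smul, Matrix.mul_assoc]

/-- The Markov parameters of the stochastic part depend only on `(y, u, μ)`. -/
lemma markov_eq {nx' nn' : ℕ} {S' : GLSS Ω d nx' nn' nu ny} (hS : IsSGLSS P μ 𝓔 p y u S)
    (hS' : IsSGLSS P μ 𝓔 p y u S') (hμ : IsAdmissible P μ 𝓔 p) (σ : Fin d) (v : List (Fin d)) :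
    S.C * matWord S.A v * (S.stochasticPart P μ p u).G P μ p σ =
      S'.C * matWord S'.A v * (S'.stochasticPart P μ p u).G P μ p σ := by
  -- On allowed words both sides are the same covariance of the residual of `y`, up to one common
  -- positive factor; on the others both sides are zero.
  by_cases hv : (σ :: v).IsChain fun a b => (a, b) ∈ 𝓔
  · have h := (hS.crossCov_residual_output hμ σ v hv).symm.trans
      (hS'.crossCov_residual_output hμ σ v hv)
    refine smul_right_injective _ (ne_of_gt (List.prod_pos fun a ha => ?_)) h
    obtain ⟨τ, -, rfl⟩ := List.mem_map.1 ha
    exact Real.sqrt_pos.2 (hμ.p_pos τ)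
  · rw [Matrix.mul_assoc, hS.matWord_mul_G_eq_zero σ v hv, Matrix.mul_assoc,
      hS'.matWord_mul_G_eq_zero σ v hv, Matrix.mul_zero, Matrix.mul_zero]

end IsSGLSS

/-! ### Rank of the Hankel map and minimality. -/

section Hankel

variable {d ny : ℕ}

/-- The reachability map of a family of matrices: it sends basis vectors to columns of
`A_w G_σ`. -/
def reachMap {n : ℕ} (A : Fin d → Matrix (Fin n) (Fin n) ℝ)
    (G : Fin d → Matrix (Fin n) (Fin ny) ℝ) :
    ((List (Fin d) × Fin d × Fin ny) →₀ ℝ) →ₗ[ℝ] (Fin n → ℝ) :=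
  Finsupp.linearCombination ℝ fun k => (matWord A k.1 * G k.2.1).col k.2.2

/-- The observability map: it sends a state to its images under all `C A_w`. -/
def obsMap {n : ℕ} (A : Fin d → Matrix (Fin n) (Fin n) ℝ) (C : Matrix (Fin ny) (Fin n) ℝ) :
    (Fin n → ℝ) →ₗ[ℝ] (List (Fin d) → Fin ny → ℝ) :=
  LinearMap.pi fun w => (C * matWord A w).mulVecLin

/-- Two representations with the same Markov parameters: the reachable and observable one has the
smaller dimension. -/
lemma dim_le_of_markov_eq {n n' : ℕ} {A : Fin d → Matrix (Fin n) (Fin n) ℝ}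
    {G : Fin d → Matrix (Fin n) (Fin ny) ℝ} {C : Matrix (Fin ny) (Fin n) ℝ}
    {A' : Fin d → Matrix (Fin n') (Fin n') ℝ} {G' : Fin d → Matrix (Fin n') (Fin ny) ℝ}
    {C' : Matrix (Fin ny) (Fin n') ℝ}
    (hobs : ∀ ξ : Fin n → ℝ, (∀ w : List (Fin d), (C * matWord A w) *ᵥ ξ = 0) → ξ = 0)
    (hreach : Submodule.span ℝ {b : Fin n → ℝ | ∃ (w : List (Fin d)) (σ : Fin d) (j : Fin ny),
      b = (matWord A w * G σ).col j} = ⊤)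
    (h : ∀ σ v, C * matWord A v * G σ = C' * matWord A' v * G' σ) : n ≤ n' := by
  have hcomp : obsMap A C ∘ₗ reachMap A G = obsMap A' C' ∘ₗ reachMap A' G' := by
    refine Finsupp.lhom_ext' fun k => LinearMap.ext_ring ?_
    funext w
    simp only [obsMap, reachMap, LinearMap.comp_apply, Finsupp.lsingle_apply,
      Finsupp.linearCombination_single, one_smul, LinearMap.pi_apply, Matrix.mulVecLin_apply]
    -- The Markov parameter of a concatenated word factors as `C A_w` times `A_v G_σ`, which is an
    -- entry of the composite of observability and reachability maps.
    have e := h k.2.1 (k.1 ++ w)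
    rw [matWord_append, matWord_append, ← Matrix.mul_assoc, ← Matrix.mul_assoc,
      Matrix.mul_assoc _ _ (G _), Matrix.mul_assoc _ _ (G' _)] at e
    ext i
    exact congrFun (congrFun e i) k.2.2
  have hsurj : LinearMap.range (reachMap A G) = ⊤ := by
    rw [reachMap, Finsupp.range_linearCombination, ← hreach]
    congr 1
    ext b
    constructor
    · rintro ⟨k, rfl⟩
      exact ⟨k.1, k.2.1, k.2.2, rfl⟩
    · rintro ⟨w, σ, j, rfl⟩
      exact ⟨(w, σ, j), rfl⟩
  have hinj : Function.Injective (obsMap A C) := by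
    rw [injective_iff_map_eq_zero]
    intro ξ hξ
    exact hobs ξ fun w => congrFun hξ w
  -- Reachability makes the first map surjective and observability makes the second injective, so
  -- the composite has rank exactly `n`.
  have h1 : Module.finrank ℝ (LinearMap.range (obsMap A C ∘ₗ reachMap A G)) = n := by
    rw [LinearMap.range_comp, hsurj, Submodule.map_top, LinearMap.finrank_range_of_inj hinj,
      Module.finrank_fin_fun]
  rw [hcomp, LinearMap.range_comp] at h1
  calc n = _ := h1.symm
    _ ≤ Module.finrank ℝ (LinearMap.range (reachMap A' G')) := Submodule.finrank_map_le _ _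
    _ ≤ Module.finrank ℝ (Fin n' → ℝ) := Submodule.finrank_le _
    _ = n' := Module.finrank_fin_fun ℝ

end Hankel

end SwitchedStoch

end

theorem corollary2 {Ω : Type*} [MeasurableSpace Ω] (P : MeasureTheory.Measure Ω)
    [MeasureTheory.IsProbabilityMeasure P] {d nu ny : ℕ}
    (μ : SwitchedStoch.Proc Ω (Fin d)) (𝓔 : Set (Fin d × Fin d)) (p : Fin d → ℝ)
    (hμ : SwitchedStoch.IsAdmissible P μ 𝓔 p)
    (y : SwitchedStoch.Proc Ω (Fin ny)) (u : SwitchedStoch.Proc Ω (Fin nu))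
    {nx nn : ℕ} (S : SwitchedStoch.GLSS Ω d nx nn nu ny)
    (hS : SwitchedStoch.IsSGLSS P μ 𝓔 p y u S)
    (hobs : (S.stochasticPart P μ p u).Observable)
    (hreach : (S.stochasticPart P μ p u).Reachable P μ p)
    {nx' nn' : ℕ} (S' : SwitchedStoch.GLSS Ω d nx' nn' nu ny)
    (hS' : SwitchedStoch.IsSGLSS P μ 𝓔 p y u S') :
    nx ≤ nx' := by
  exact SwitchedStoch.dim_le_of_markov_eq hobs hreach fun σ v => hS.markov_eq hS' hμ σ v
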